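/- There is an absolute constant $c_6>0$ with the following property. Let $S\subset\mathbb{R}^D$ ($D\ge 1$) be a finite data set whose doubling dimension is at most $d$, where $d\ge 2$; that is, for some integer $k\le d$, for every closed ball $B(x,r)\subset\mathbb{R}^D$ the set $B(x,r)\cap S$ can be covered by $2^{k}$ balls of radius $r/2$. Build an RPTree-Max on $S$: the root cell is $S$, and every cell $C$ (a nonempty subset of $S$) is split by choosing a uniformly random unit vector $v\in\mathbb{R}^D$ and, independently, $\delta$ uniformly at random in $[-1,1]\cdot 6\tilde\Delta/\sqrt D$, where $\tilde\Delta=\max_{y\in C}\|p-y\|$ for a data point $p\in C$ that is selected by an arbitrary fixed rule from $C$ and the position of its node in the tree, and sending $x\in C$ to the left child if $x\cdot v<\mathrm{median}\{z\cdot v: z\in C\}+\delta$ and to the right child otherwise; the random choices at different nodes are independent, and the splitting is continued indefinitely (a cell with a single point stays the same). The radius of a cell is the radius of the smallest ball of $\mathbb{R}^D$ containing its data. Then for every fixed closed ball $B$ of radius $R>0$ in $\mathbb{R}^D$, with probability greater than $3/4$ over the construction of the tree, there is a cell $C$ of the tree such that $B\cap S\subseteq C$ (all the data in $B$ lies, unsplit,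 in $C$) and the radius of $C$ is at most $c_6\cdot R\, d\sqrt d\,\log d$. -/

import Mathlib

open MeasureTheory ProbabilityTheory
open scoped NNReal ENNReal

noncomputable section

namespace RPTree

/-- The ambient Euclidean space `ℝ^D`. -/
abbrev Pt (D : ℕ) : Type := EuclideanSpace ℝ (Fin D)

/-! ### Doubling dimension -/

/-- For every closed ball `B(x, r)` of `ℝ^D`, the set `B(x, r) ∩ S` can be covered by at most
`2 ^ k` closed balls of radius `r / 2`. -/
def DoublingBound {D : ℕ} (S : Set (Pt D)) (k : ℕ) : Prop :=
  ∀ (x : Pt D) (r : ℝ), ∃ T : Finset (Pt D), T.card ≤ 2 ^ k ∧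
    Metric.closedBall x r ∩ S ⊆ ⋃ c ∈ T, Metric.closedBall c (r / 2)

/-- The doubling dimension of `S`: the smallest `k` with the above covering property
(`⊤` if there is none). -/
def doublingDim {D : ℕ} (S : Set (Pt D)) : ℕ∞ :=
  ⨅ (k : ℕ) (_ : DoublingBound S k), (k : ℕ∞)

/-! ### One random split -/

/-- The median of a finite multiset of reals: the mean of the two middle entries
(which coincide when the number of entries is odd) of the sorted list. -/
def median (s : Multiset ℝ) : ℝ :=
  (s.sort.getD ((s.card - 1) / 2) 0 + s.sort.getD (s.card / 2) 0) / 2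

/-- The random choices made at one node: a unit direction `v` and the relative position
`u ∈ [-1, 1]` of the split point. -/
abbrev Choice (D : ℕ) : Type := Metric.sphere (0 : Pt D) 1 × ℝ

/-- The estimate `max {‖p - y‖ : y ∈ C}` of the radius of a cell `C`. -/
def radiusEstimate {D : ℕ} (C : Finset (Pt D)) (p : Pt D) : ℝ :=
  (C.sup fun y => nndist p y : ℝ≥0)

/-- The threshold of a split: the median of the projections of the data in the cell onto `v`, plus
`δ = u * 6 Δ / √D`, where `Δ` is the radius estimate from the point `p`. -/
def threshold {D : ℕ} (C : Finset (Pt D)) (p : Pt D) (w : Choice D) : ℝ :=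
  median (C.val.map fun z => inner ℝ z (w.1 : Pt D)) +
    w.2 * (6 * radiusEstimate C p / Real.sqrt D)

open Classical in
/-- The child (`true` is left, `false` is right) of the cell `C` under the split with random
choices `w`. -/
def child {D : ℕ} (C : Finset (Pt D)) (p : Pt D) (w : Choice D) : Bool → Finset (Pt D)
  | true => C.filter fun z => inner ℝ z (w.1 : Pt D) < threshold C p w
  | false => C.filter fun z => ¬ inner ℝ z (w.1 : Pt D) < threshold C p w

/-! ### The tree -/

/-- A node of the infinite binary tree, given by the sequence of turns on the path from the root,
the most recent turn first. -/
abbrev Node : Type := List Bool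

/-- The data in the cell at a node of the tree built on the data set `S`. The point used for the
radius estimate at node `a`, when the data in its cell is `C`, is `pivot a C`; the random choices
at node `a` are `ω a`. -/
def cell {D : ℕ} (S : Finset (Pt D)) (pivot : Node → Finset (Pt D) → Pt D)
    (ω : Node → Choice D) : Node → Finset (Pt D)
  | [] => S
  | b :: a => child (cell S pivot ω a) (pivot a (cell S pivot ω a)) (ω a) b

/-- The radius of a cell: the radius of the smallest ball of `ℝ^D` that contains its data. -/
def cellRadius {D : ℕ} (C : Finset (Pt D)) : ℝ :=
  sInf {r : ℝ | 0 ≤ r ∧ ∃ x : Pt D, (C : Set (Pt D)) ⊆ Metric.closedBall x r}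

/-! ### The randomness -/

/-- The uniform probability measure on the unit sphere of `ℝ^D`. -/
def uniformDirection (D : ℕ) : Measure (Metric.sphere (0 : Pt D) 1) :=
  ((volume : Measure (Pt D)).toSphere Set.univ)⁻¹ • (volume : Measure (Pt D)).toSphere

/-- The uniform probability measure on `[-1, 1]`. -/
def uniformOffset : Measure ℝ := ProbabilityTheory.cond volume (Set.Icc (-1) 1)

/-- The law of the choices at one node: the direction and the offset are independent. -/
def choiceLaw (D : ℕ) : Measure (Choice D) := (uniformDirection D).prod uniformOffset

/-- The law of all random choices: independent choices at the nodes. -/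
def treeLaw (D : ℕ) : Measure (Node → Choice D) := Measure.infinitePi fun _ => choiceLaw D

instance (D : ℕ) [NeZero D] : IsProbabilityMeasure (uniformDirection D) := by
  have : Nonempty (Fin D) := ⟨⟨0, Nat.pos_of_ne_zero (NeZero.ne D)⟩⟩
  have : Nontrivial (Pt D) :=
    Module.nontrivial_of_finrank_pos (R := ℝ) (by
      simpa using Nat.pos_of_ne_zero (NeZero.ne D))
  refine ⟨?_⟩
  rw [uniformDirection, Measure.smul_apply, smul_eq_mul]
  refine ENNReal.inv_mul_cancel ?_ (measure_ne_top _ _)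
  rw [Ne, Measure.measure_univ_eq_zero]
  exact Measure.toSphere_ne_zero _

instance : IsProbabilityMeasure uniformOffset :=
  ProbabilityTheory.cond_isProbabilityMeasure_of_finite (by simp) (by simp)

instance (D : ℕ) [NeZero D] : IsProbabilityMeasure (choiceLaw D) := by
  unfold choiceLaw; infer_instance

instance (D : ℕ) [NeZero D] : IsProbabilityMeasure (treeLaw D) := by
  unfold treeLaw; infer_instance

end RPTree

end

namespace RPTree

/-! ### Moments of a linear functional on the sphere -/

/-! Choose a data point `y` with all the data of the ball inside `B(y, r)`, `r = 2R`, and let `A` be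
the data in `B(y, r)`. Follow the cell containing `A` until its diameter drops to `M` or a split
cuts `A`. The cost of a split is its chance of cutting `A`; it is enough that the total expected
cost before stopping be below `1/4`.

Cost of one split: by chaining through nets of doubling size, with even moments of a linear
functional on the sphere, the projection of `A` has expected width `O(r √(d/D))`, while the
threshold is spread over a length comparable to `diam C / √D`. So `A` is cut with probability at
most `12 r √d / diam C` (`choiceLaw_split_le`).

Progress of one split: for each dyadic scale `M 2^j`, cover the data near `y` by `2^(dm)` balls of
radius about `M 2^j / √d` or less, and take the pairs of centres at distance at least `M 2^j / 2`. A
pair is live in a cell that meets both balls. A cell with diameter in `(M 2^j, 2 M 2^j]` separates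
each live pair with constant probability (`le_choiceLaw_separates`), and separated pairs are dead in
both children. Hence the expected loss of `1 + log #live` is at least a constant, and the expected
number of splits at one scale is `O(d m) = O(d log d)`.

Weighting scale `j` by a multiple of `r √d / (M 2^j)` and summing yields a potential whose expected
loss pays for each split (`lintegral_potential_child_add_le`). A supermartingale argument
(`treeLaw_forall_active_le`) bounds the failure probability by the potential of the root. The
weights form a geometric series, so this is `O(r d √d log d / M)`, and `M` is chosen to make it
small. -/

theorem integral_pow_mul_exp_neg_sq (p : ℕ) :
    ∫ t : ℝ, t ^ (2 * p) * Real.exp (-t ^ 2) = Real.Gamma (p + 1 / 2) := by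
  have h := integral_comp_abs (f := fun t : ℝ => t ^ (2 * p) * Real.exp (-t ^ 2))
  simp only [pow_mul, sq_abs] at h ⊢
  rw [h]
  have h2 := integral_rpow_mul_exp_neg_rpow (p := 2) (q := 2 * p) (by norm_num)
    (by have : (0 : ℝ) ≤ 2 * p := by positivity
        linarith)
  rw [← mul_right_inj' (two_ne_zero' ℝ), ← mul_assoc] at h2
  rw [show (2 : ℝ) * (1 / 2) = 1 by norm_num, one_mul,
    show (2 * (p : ℝ) + 1) / 2 = p + 1 / 2 by ring] at h2
  rw [← h2]
  congr 1
  refine setIntegral_congr_fun measurableSet_Ioi fun t ht => ?_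
  rw [Real.rpow_mul (le_of_lt ht)]
  norm_num [Real.rpow_natCast]

/-- In an orthonormal basis that starts with `x` the integrand is a product of one-variable
functions, so Fubini leaves one moment integral and `D - 1` plain Gaussian ones. -/
theorem integral_inner_pow_mul_exp_neg_norm_sq {D : ℕ} (p : ℕ) (x : Pt D) (hx : ‖x‖ = 1) :
    ∫ v : Pt D, (inner ℝ x v) ^ (2 * p) * Real.exp (-‖v‖ ^ 2) =
      Real.Gamma (p + 1 / 2) * Real.Gamma (1 / 2) ^ (D - 1) := by
  classical
  have hD : 0 < D := by
    rcases Nat.eq_zero_or_pos D with rfl | h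
    · have : x = 0 := Subsingleton.elim _ _
      simp [this] at hx
    · exact h
  let i₀ : Fin D := ⟨0, hD⟩
  obtain ⟨b, hb⟩ := Orthonormal.exists_orthonormalBasis_extension_of_card_eq (𝕜 := ℝ)
    (E := Pt D) (ι := Fin D) (by simp) (v := fun _ => x) (s := {i₀})
    (by
      refine ⟨fun i => by simpa using hx, fun i j hij => ?_⟩
      exact absurd (Subsingleton.elim i j) hij)
  have hb0 : b i₀ = x := hb i₀ (by simp)
  have key : ∀ v : Pt D, (inner ℝ x v) ^ (2 * p) * Real.exp (-‖v‖ ^ 2) =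
      (fun y : Fin D → ℝ => ∏ i, (if i = i₀ then y i ^ (2 * p) else 1) * Real.exp (-(y i) ^ 2))
        (WithLp.ofLp (b.repr v)) := by
    intro v
    simp only
    rw [Finset.prod_mul_distrib, Finset.prod_ite_eq', ← Real.exp_sum, if_pos (Finset.mem_univ _),
      b.repr_apply_apply, hb0, ← b.repr.norm_map v, EuclideanSpace.norm_sq_eq]
    simp
  rw [integral_congr_ae (Filter.Eventually.of_forall key)]
  have hcomp := ((PiLp.volume_preserving_ofLp (Fin D)).comp b.measurePreserving_repr).integral_comp
    (((MeasurableEquiv.toLp 2 (Fin D → ℝ)).symm.measurableEmbedding).comp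
      b.repr.toHomeomorph.measurableEmbedding)
    (fun y : Fin D → ℝ => ∏ i, (if i = i₀ then y i ^ (2 * p) else 1) * Real.exp (-(y i) ^ 2))
  simp only [Function.comp_apply] at hcomp
  rw [hcomp, integral_fintype_prod_volume_eq_prod
    (f := fun i (t : ℝ) => (if i = i₀ then t ^ (2 * p) else 1) * Real.exp (-t ^ 2)),
    ← Finset.mul_prod_erase _ _ (Finset.mem_univ i₀)]
  congr 1
  · simpa using integral_pow_mul_exp_neg_sq p
  · rw [Finset.prod_congr rfl (g := fun _ => Real.Gamma (1 / 2))]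
    · simp
    · intro i hi
      have := integral_pow_mul_exp_neg_sq 0
      simpa [Finset.ne_of_mem_erase hi] using this

theorem integral_radial (D p : ℕ) (hD : 0 < D) :
    ∫ r : Set.Ioi (0 : ℝ), (r : ℝ) ^ (2 * p) * Real.exp (-(r : ℝ) ^ 2)
      ∂(Measure.volumeIoiPow (D - 1)) = Real.Gamma (D / 2 + p) / 2 := by
  rw [Measure.volumeIoiPow]
  simp only [ENNReal.ofReal]
  rw [integral_withDensity_eq_integral_smul
    ((measurable_subtype_coe.pow_const _).real_toNNReal),
    integral_subtype_comap measurableSet_Ioi fun a : ℝ =>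
      Real.toNNReal (a ^ (D - 1)) • (a ^ (2 * p) * Real.exp (-a ^ 2))]
  have h2 := integral_rpow_mul_exp_neg_rpow (p := 2) (q := ((D - 1 + 2 * p : ℕ) : ℝ)) (by norm_num)
    (by have : (0 : ℝ) ≤ ((D - 1 + 2 * p : ℕ) : ℝ) := by positivity
        linarith)
  have h3 : (((D - 1 + 2 * p : ℕ) : ℝ) + 1) / 2 = D / 2 + p := by
    push_cast [Nat.cast_sub (show 1 ≤ D from hD)]; ring
  rw [h3] at h2
  rw [div_eq_inv_mul, ← one_div, ← h2]
  refine setIntegral_congr_fun measurableSet_Ioi fun t ht => ?_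
  rw [NNReal.smul_def, Real.coe_toNNReal _ (pow_nonneg (le_of_lt ht) _), Real.rpow_natCast, pow_add,
    smul_eq_mul, mul_assoc]
  norm_num

/-- Polar coordinates: the Gaussian integral factors into a spherical moment and a radial Gamma
integral. -/
theorem integral_inner_pow_toSphere {D : ℕ} (hD : 0 < D) (p : ℕ) (x : Pt D) (hx : ‖x‖ = 1) :
    (∫ v : Metric.sphere (0 : Pt D) 1, (inner ℝ x (v : Pt D)) ^ (2 * p)
      ∂((volume : Measure (Pt D)).toSphere)) * (Real.Gamma (D / 2 + p) / 2) =
      Real.Gamma (p + 1 / 2) * Real.Gamma (1 / 2) ^ (D - 1) := by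
  have : Nontrivial (Pt D) :=
    Module.nontrivial_of_finrank_pos (R := ℝ) (by simpa using hD)
  rw [← integral_inner_pow_mul_exp_neg_norm_sq p x hx, ← integral_radial D p hD,
    ← integral_prod_mul]
  have h := (volume : Measure (Pt D)).measurePreserving_homeomorphUnitSphereProd.integral_comp
    (Homeomorph.measurableEmbedding _)
    (fun z : Metric.sphere (0 : Pt D) 1 × Set.Ioi (0 : ℝ) =>
      (inner ℝ x (z.1 : Pt D)) ^ (2 * p) * ((z.2 : ℝ) ^ (2 * p) * Real.exp (-(z.2 : ℝ) ^ 2)))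
  rw [finrank_euclideanSpace_fin] at h
  rw [← h]
  have h2 := integral_subtype_comap (μ := (volume : Measure (Pt D)))
    (measurableSet_singleton (0 : Pt D)).compl
    (fun v : Pt D => (inner ℝ x v) ^ (2 * p) * Real.exp (-‖v‖ ^ 2))
  rw [restrict_compl_singleton] at h2
  rw [← h2]
  refine integral_congr_ae (Filter.Eventually.of_forall fun v => ?_)
  have hv : ‖(v : Pt D)‖ ≠ 0 := norm_ne_zero_iff.2 v.2
  simp [inner_smul_right, mul_pow]
  field_simp

theorem integral_inner_pow_uniformDirection {D : ℕ} [NeZero D] (p : ℕ) (x : Pt D)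
    (hx : ‖x‖ = 1) :
    (∫ v, (inner ℝ x (v : Pt D)) ^ (2 * p) ∂(uniformDirection D)) * Real.Gamma (D / 2 + p) *
      Real.Gamma (1 / 2) = Real.Gamma (p + 1 / 2) * Real.Gamma (D / 2) := by
  have hD := Nat.pos_of_ne_zero (NeZero.ne D)
  have h0 := integral_inner_pow_toSphere hD 0 x hx
  have hp := integral_inner_pow_toSphere hD p x hx
  simp only [mul_zero, pow_zero, Nat.cast_zero, add_zero, zero_add, integral_const,
    smul_eq_mul, mul_one] at h0
  rw [uniformDirection, integral_smul_measure, ENNReal.toReal_inv, smul_eq_mul]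
  change (((volume : Measure (Pt D)).toSphere.real Set.univ)⁻¹ * _) * _ * _ = _
  have g1 : 0 < Real.Gamma (1 / 2) := Real.Gamma_pos_of_pos (by norm_num)
  have g2 : 0 < Real.Gamma (D / 2 : ℝ) := Real.Gamma_pos_of_pos (by positivity)
  set m := (volume : Measure (Pt D)).toSphere.real Set.univ
  set J := ∫ v : Metric.sphere (0 : Pt D) 1, (inner ℝ x (v : Pt D)) ^ (2 * p)
      ∂((volume : Measure (Pt D)).toSphere)
  have hm : m ≠ 0 := by
    intro h
    rw [h, zero_mul] at h0
    exact (by positivity : 0 < Real.Gamma (1 / 2) * Real.Gamma (1 / 2) ^ (D - 1)).ne h0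
  have hG : 0 < Real.Gamma (1 / 2) ^ (D - 1) := by positivity
  rw [inv_mul_eq_div, div_mul_eq_mul_div, div_mul_eq_mul_div, div_eq_iff hm]
  have : J * Real.Gamma (D / 2 + p) = 2 * (Real.Gamma (p + 1 / 2) * Real.Gamma (1 / 2) ^ (D - 1)) := by
    linarith
  have h0' : m * Real.Gamma (D / 2) = 2 * (Real.Gamma (1 / 2) * Real.Gamma (1 / 2) ^ (D - 1)) := by
    linarith
  calc J * Real.Gamma (D / 2 + p) * Real.Gamma (1 / 2)
      = Real.Gamma (p + 1 / 2) * (2 * (Real.Gamma (1 / 2) * Real.Gamma (1 / 2) ^ (D - 1))) := by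
        rw [this]; ring
    _ = _ := by rw [← h0']; ring

/-- The functional equation of Gamma turns the closed form into a recurrence, which is all that is
used of the moments later. -/
theorem integral_inner_pow_succ {D : ℕ} [NeZero D] (p : ℕ) (x : Pt D) (hx : ‖x‖ = 1) :
    (D + 2 * p) * ∫ v, (inner ℝ x (v : Pt D)) ^ (2 * (p + 1)) ∂(uniformDirection D) =
      (2 * p + 1) * ∫ v, (inner ℝ x (v : Pt D)) ^ (2 * p) ∂(uniformDirection D) := by
  have hD : (0 : ℝ) < D := Nat.cast_pos.2 (Nat.pos_of_ne_zero (NeZero.ne D))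
  have h1 := integral_inner_pow_uniformDirection p x hx
  have h2 := integral_inner_pow_uniformDirection (p + 1) x hx
  rw [show (D / 2 + (p + 1 : ℕ) : ℝ) = (D / 2 + p) + 1 by push_cast; ring,
    Real.Gamma_add_one (by positivity),
    show ((p + 1 : ℕ) + 1 / 2 : ℝ) = (p + 1 / 2) + 1 by push_cast; ring,
    Real.Gamma_add_one (by positivity), mul_assoc (_ + _ : ℝ) _ _, ← h1] at h2
  have g1 : 0 < Real.Gamma (1 / 2) := Real.Gamma_pos_of_pos (by norm_num)
  have g2 : 0 < Real.Gamma (D / 2 + p : ℝ) := Real.Gamma_pos_of_pos (by positivity)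
  have g3 := mul_pos g2 g1
  refine mul_right_cancel₀ g3.ne' ?_
  linear_combination 2 * h2

theorem integrable_of_continuous {D : ℕ} [NeZero D] {f : Metric.sphere (0 : Pt D) 1 → ℝ}
    (hf : Continuous f) : Integrable f (uniformDirection D) :=
  hf.integrable_of_hasCompactSupport (HasCompactSupport.of_compactSpace f)

theorem integral_inner_pow_unit_zero {D : ℕ} [NeZero D] (x : Pt D) :
    ∫ v, (inner ℝ x (v : Pt D)) ^ (2 * 0) ∂(uniformDirection D) = 1 := by
  simp

theorem integral_inner_pow_smul {D : ℕ} [NeZero D] (p : ℕ) (x : Pt D) (hx : x ≠ 0) :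
    ∫ v, (inner ℝ x (v : Pt D)) ^ (2 * p) ∂(uniformDirection D) =
      ‖x‖ ^ (2 * p) *
        ∫ v, (inner ℝ (‖x‖⁻¹ • x) (v : Pt D)) ^ (2 * p) ∂(uniformDirection D) := by
  have : ‖x‖ ≠ 0 := norm_ne_zero_iff.2 hx
  rw [← integral_const_mul]
  congr 1
  ext v
  rw [real_inner_smul_left, mul_pow, inv_pow, mul_inv_cancel_left₀ (by positivity)]

theorem integral_inner_sq {D : ℕ} [NeZero D] (x : Pt D) :
    ∫ v, (inner ℝ x (v : Pt D)) ^ 2 ∂(uniformDirection D) = ‖x‖ ^ 2 / D := by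
  have hD : (0 : ℝ) < D := Nat.cast_pos.2 (Nat.pos_of_ne_zero (NeZero.ne D))
  rcases eq_or_ne x 0 with rfl | hx
  · simp
  have h1 := integral_inner_pow_succ 0 (‖x‖⁻¹ • x) (norm_smul_inv_norm (𝕜 := ℝ) hx)
  rw [integral_inner_pow_unit_zero] at h1
  have h2 := integral_inner_pow_smul 1 x hx
  rw [mul_one] at h2
  rw [h2, eq_div_iff hD.ne', mul_assoc]
  norm_num at h1 ⊢
  rw [mul_comm _ (D : ℝ), h1]
  exact mul_one _

/-- The even moments of a linear functional on the sphere are at most Gaussian. -/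
theorem integral_inner_pow_le {D : ℕ} [NeZero D] (p : ℕ) (x : Pt D) :
    ∫ v, (inner ℝ x (v : Pt D)) ^ (2 * p) ∂(uniformDirection D) ≤
      (∏ j ∈ Finset.range p, (2 * j + 1 : ℝ)) * (‖x‖ ^ 2 / D) ^ p := by
  have hD : (0 : ℝ) < D := Nat.cast_pos.2 (Nat.pos_of_ne_zero (NeZero.ne D))
  rcases eq_or_ne x 0 with rfl | hx
  · rcases Nat.eq_zero_or_pos p with rfl | hp
    · simp
    · simp [hp.ne']
  rw [integral_inner_pow_smul p x hx, div_pow, ← pow_mul, mul_div_assoc', mul_comm, mul_div_right_comm]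
  refine mul_le_mul_of_nonneg_right ?_ (by positivity)
  have hu : ‖‖x‖⁻¹ • x‖ = 1 := norm_smul_inv_norm (𝕜 := ℝ) hx
  induction p with
  | zero => simp
  | succ p ih =>
    have h1 := integral_inner_pow_succ p (‖x‖⁻¹ • x) hu
    set J := ∫ v, (inner ℝ (‖x‖⁻¹ • x) (v : Pt D)) ^ (2 * (p + 1)) ∂(uniformDirection D)
    have hJ : 0 ≤ J := integral_nonneg fun v => (even_two_mul _).pow_nonneg _
    rw [Finset.prod_range_succ, pow_succ, mul_div_mul_comm]
    have h3 : J * D ≤ (2 * p + 1) *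
        ∫ v, (inner ℝ (‖x‖⁻¹ • x) (v : Pt D)) ^ (2 * p) ∂(uniformDirection D) := by
      rw [← h1]
      have : 0 ≤ 2 * (p : ℝ) * J := by positivity
      linarith
    rw [mul_div_assoc', le_div_iff₀ hD]
    refine h3.trans ?_
    rw [mul_comm]
    gcongr

/-! ### Projections of sets of small doubling dimension -/

/-- A bound on the largest projection of at most `4 ^ p` vectors. -/
theorem exists_bound_abs_inner {D : ℕ} [NeZero D] {ι : Type*} (I : Finset ι) (w : ι → Pt D)
    {L : ℝ} (hL : 0 < L) (hw : ∀ i ∈ I, ‖w i‖ ≤ L) {p : ℕ} (hp : 0 < p) (hI : I.card ≤ 4 ^ p) :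
    ∃ g : Metric.sphere (0 : Pt D) 1 → ℝ, Continuous g ∧ (∀ v, 0 ≤ g v) ∧
      (∀ i ∈ I, ∀ v : Metric.sphere (0 : Pt D) 1, |inner ℝ (w i) (v : Pt D)| ≤ g v) ∧
      ∫ v, g v ∂(uniformDirection D) ≤ 4 * L * Real.sqrt (2 * p / D) := by
  have hD : (0 : ℝ) < D := Nat.cast_pos.2 (Nat.pos_of_ne_zero (NeZero.ne D))
  have hp' : (0 : ℝ) < p := Nat.cast_pos.2 hp
  -- `B² = 8 p L² / D` makes each normalised `2p`-th moment at most `4⁻ᵖ`, so that the sum over `I`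
  -- has mean at most `1`. Since `|t| ≤ 1 + t^(2p)`, the majorant `B (1 + ∑ …)` has mean at most
  -- `2B`.
  set B : ℝ := 2 * L * Real.sqrt (2 * p / D) with hB
  have hBpos : 0 < B := by positivity
  have hB2 : B ^ 2 = 4 * (2 * p) * (L ^ 2 / D) := by
    rw [hB, mul_pow, Real.sq_sqrt (by positivity)]; ring
  have hcont : ∀ i, Continuous fun v : Metric.sphere (0 : Pt D) 1 =>
      (inner ℝ (w i) (v : Pt D) / B) ^ (2 * p) := fun i => by fun_prop
  have hnn : ∀ i (v : Metric.sphere (0 : Pt D) 1),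
      0 ≤ (inner ℝ (w i) (v : Pt D) / B) ^ (2 * p) := fun i v => (even_two_mul p).pow_nonneg _
  refine ⟨fun v => B * (1 + ∑ i ∈ I, (inner ℝ (w i) (v : Pt D) / B) ^ (2 * p)), ?_, ?_, ?_, ?_⟩
  · fun_prop
  · intro v
    have := Finset.sum_nonneg fun i (_ : i ∈ I) => hnn i v
    positivity
  · intro i hi v
    have h1 := Finset.single_le_sum (fun j _ => hnn j v) hi
    set t := inner ℝ (w i) (v : Pt D) / B with ht
    have h2 : |inner ℝ (w i) (v : Pt D)| = B * |t| := by
      rw [ht, abs_div, abs_of_pos hBpos]; field_simp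
    rw [h2]
    refine mul_le_mul_of_nonneg_left ?_ hBpos.le
    rcases le_total |t| 1 with h | h
    · linarith [hnn i v]
    · have : |t| ≤ |t| ^ (2 * p) := le_self_pow₀ h (by omega)
      rw [(even_two_mul p).pow_abs] at this
      linarith
  · have hint : ∀ i ∈ I, ∫ v : Metric.sphere (0 : Pt D) 1, (inner ℝ (w i) (v : Pt D) / B) ^ (2 * p)
        ∂(uniformDirection D) ≤ (1 / 4) ^ p := by
      intro i hi
      simp_rw [div_pow _ B]
      rw [integral_div, div_le_iff₀ (by positivity), pow_mul B, hB2,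
        ← mul_pow]
      refine (integral_inner_pow_le p (w i)).trans ?_
      rw [show (1 : ℝ) / 4 * (4 * (2 * p) * (L ^ 2 / D)) = 2 * p * (L ^ 2 / D) by ring, mul_pow]
      have h3 : (∏ j ∈ Finset.range p, (2 * j + 1 : ℝ)) ≤ (2 * p) ^ p := by
        calc (∏ j ∈ Finset.range p, (2 * j + 1 : ℝ)) ≤ ∏ j ∈ Finset.range p, (2 * p : ℝ) := by
              refine Finset.prod_le_prod (fun j _ => by positivity) fun j hj => ?_
              have : (j : ℝ) + 1 ≤ p := by exact_mod_cast Finset.mem_range.1 hj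
              linarith
          _ = _ := by simp
      have h4 := hw i hi
      gcongr
    rw [integral_const_mul, integral_add (integrable_const _)
      (integrable_finsetSum _ fun i _ => integrable_of_continuous (hcont i)),
      integral_finsetSum _ fun i _ => integrable_of_continuous (hcont i)]
    have h5 : ∑ i ∈ I, ∫ v : Metric.sphere (0 : Pt D) 1, (inner ℝ (w i) (v : Pt D) / B) ^ (2 * p)
        ∂(uniformDirection D) ≤ 1 := by
      refine (Finset.sum_le_sum hint).trans ?_
      rw [Finset.sum_const, nsmul_eq_mul, div_pow, one_pow, mul_one_div, div_le_one (by positivity)]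
      exact_mod_cast hI
    have h6 : ∫ v : Metric.sphere (0 : Pt D) 1, (1 : ℝ) ∂(uniformDirection D) = 1 := by simp
    rw [h6]
    calc B * (1 + _) ≤ B * (1 + 1) := by gcongr
      _ = _ := by rw [hB]; ring

/-- Each ball of one net is covered anew by at most `2 ^ d` balls of half the radius. -/
theorem DoublingBound.exists_nets {D : ℕ} {S : Set (Pt D)} {d : ℕ} (hS : DoublingBound S d)
    (z : Pt D) (r : ℝ) :
    ∃ T : ℕ → Finset (Pt D), T 0 = {z} ∧ (∀ k, (T k).card ≤ 2 ^ (d * k)) ∧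
      ∀ k, Metric.closedBall z r ∩ S ⊆ ⋃ c ∈ T k, Metric.closedBall c (r / 2 ^ k) := by
  classical
  choose f hf hcov using hS
  let T : ℕ → Finset (Pt D) := fun k =>
    Nat.rec {z} (fun k t => t.biUnion fun c => f c (r / 2 ^ k)) k
  have hT : ∀ k, T (k + 1) = (T k).biUnion fun c => f c (r / 2 ^ k) := fun k => rfl
  refine ⟨T, rfl, fun k => ?_, fun k => ?_⟩
  · induction k with
    | zero => simp [T]
    | succ k ih =>
      rw [hT, mul_add, mul_one, pow_add]
      exact Finset.card_biUnion_le.trans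
        ((Finset.sum_le_card_nsmul _ _ _ fun c _ => hf c _).trans
          (by rw [smul_eq_mul]; gcongr))
  · induction k with
    | zero => simp [T]
    | succ k ih =>
      intro a ha
      obtain ⟨c, hc, hac⟩ := Set.mem_iUnion₂.1 (ih ha)
      obtain ⟨c', hc', hac'⟩ := Set.mem_iUnion₂.1 (hcov c (r / 2 ^ k) ⟨hac, ha.2⟩)
      refine Set.mem_iUnion₂.2 ⟨c', ?_, ?_⟩
      · rw [hT]
        exact Finset.mem_biUnion.2 ⟨c, hc, hc'⟩
      · rwa [pow_succ, ← div_div]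

theorem sum_range_succ_div_two_pow_le (K : ℕ) :
    ∑ k ∈ Finset.range K, ((k : ℝ) + 1) / 2 ^ k ≤ 4 := by
  have : ∑ k ∈ Finset.range K, ((k : ℝ) + 1) / 2 ^ k = 4 - (2 * K + 4) / 2 ^ K := by
    induction K with
    | zero => simp
    | succ K ih =>
      rw [Finset.sum_range_succ, ih, pow_succ]
      push_cast
      field_simp
      ring
  rw [this]
  have : (0 : ℝ) ≤ (2 * K + 4) / 2 ^ K := by positivity
  linarith

/-- The projection of a ball of a set of doubling dimension `d` onto a random direction has
expected length at most a multiple of `r √(d / D)`. -/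
theorem DoublingBound.exists_projection_bound {D : ℕ} [NeZero D] {S : Set (Pt D)} {d : ℕ}
    (hd : 0 < d) (hS : DoublingBound S d) (z : Pt D) {r : ℝ} (hr : 0 < r) :
    ∃ g : Metric.sphere (0 : Pt D) 1 → ℝ, Continuous g ∧ (∀ v, 0 ≤ g v) ∧
      (∀ a ∈ Metric.closedBall z r ∩ S, ∀ v : Metric.sphere (0 : Pt D) 1,
        |inner ℝ (a - z) (v : Pt D)| ≤ g v) ∧
      ∫ v, g v ∂(uniformDirection D) ≤ 36 * r * Real.sqrt (d / D) := by
  classical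
  have hD : (0 : ℝ) < D := Nat.cast_pos.2 (Nat.pos_of_ne_zero (NeZero.ne D))
  obtain ⟨T, hT0, hcard, hcov⟩ := hS.exists_nets z r
  have hlink : ∀ k, ∃ g : Metric.sphere (0 : Pt D) 1 → ℝ, Continuous g ∧ (∀ v, 0 ≤ g v) ∧
      (∀ c ∈ T k, ∀ c' ∈ T (k + 1), dist c' c ≤ 3 / 2 * r / 2 ^ k →
        ∀ v : Metric.sphere (0 : Pt D) 1, |inner ℝ (c' - c) (v : Pt D)| ≤ g v) ∧
      ∫ v, g v ∂(uniformDirection D) ≤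
        4 * (3 / 2 * r / 2 ^ k) * Real.sqrt (2 * (d * (k + 1) : ℕ) / D) := by
    intro k
    obtain ⟨g, hg, hg0, hgb, hgi⟩ := exists_bound_abs_inner (D := D)
      ((T k ×ˢ T (k + 1)).filter fun q => dist q.2 q.1 ≤ 3 / 2 * r / 2 ^ k)
      (fun q => q.2 - q.1) (L := 3 / 2 * r / 2 ^ k) (by positivity)
      (fun q hq => by rw [← dist_eq_norm]; exact (Finset.mem_filter.1 hq).2)
      -- There are at most `2^(dk) · 2^(d(k+1)) ≤ 4^(d(k+1))` links between consecutive nets.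
      (p := d * (k + 1)) (by positivity) (by
        refine (Finset.card_filter_le _ _).trans ?_
        rw [Finset.card_product]
        refine (Nat.mul_le_mul (hcard k) (hcard (k + 1))).trans ?_
        rw [← pow_add, show 4 = 2 ^ 2 by norm_num, ← pow_mul]
        refine Nat.pow_le_pow_right (by norm_num) ?_
        nlinarith)
    exact ⟨g, hg, hg0, fun c hc c' hc' h v => hgb (c, c')
      (Finset.mem_filter.2 ⟨Finset.mem_product.2 ⟨hc, hc'⟩, h⟩) v, hgi⟩
  choose g hg hg0 hgb hgi using hlink
  -- Stopping the chain at level `D` suffices: the remainder `r / 2^D` is already at most `r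
  -- √(d/D)`. A finite chain also keeps the majorant continuous.
  refine ⟨fun v => r / 2 ^ D + ∑ k ∈ Finset.range D, g k v, by fun_prop, fun v => ?_,
    fun a ha v => ?_, ?_⟩
  · have := Finset.sum_nonneg fun k (_ : k ∈ Finset.range D) => hg0 k v
    positivity
  · have hc : ∀ k, ∃ c ∈ T k, dist a c ≤ r / 2 ^ k := fun k => by
      simpa using hcov k ha
    choose c hcT hca using hc
    have hc0 : c 0 = z := by simpa [hT0] using hcT 0
    have hv : ‖(v : Pt D)‖ = 1 := by simp
    have hsum : ∀ K, inner ℝ (c K - z) (v : Pt D) =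
        ∑ k ∈ Finset.range K, inner ℝ (c (k + 1) - c k) (v : Pt D) := by
      intro K
      rw [← sum_inner, Finset.sum_range_sub, hc0]
    have h1 : |inner ℝ (a - c D) (v : Pt D)| ≤ r / 2 ^ D := by
      refine (abs_real_inner_le_norm _ _).trans ?_
      rw [hv, mul_one, ← dist_eq_norm]
      exact hca D
    have h2 : |inner ℝ (c D - z) (v : Pt D)| ≤ ∑ k ∈ Finset.range D, g k v := by
      rw [hsum]
      refine (Finset.abs_sum_le_sum_abs _ _).trans (Finset.sum_le_sum fun k _ => ?_)
      refine hgb k _ (hcT k) _ (hcT (k + 1)) ?_ v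
      have h3 := dist_triangle_left (c (k + 1)) (c k) a
      have h4 := hca (k + 1)
      have h5 := hca k
      rw [pow_succ, ← div_div] at h4
      have : 3 / 2 * r / 2 ^ k = r / 2 ^ k / 2 + r / 2 ^ k := by ring
      linarith
    calc |inner ℝ (a - z) (v : Pt D)|
        = |inner ℝ (a - c D) (v : Pt D) + inner ℝ (c D - z) (v : Pt D)| := by
          rw [← inner_add_left, sub_add_sub_cancel]
      _ ≤ _ := (abs_add_le _ _).trans (add_le_add h1 h2)
  · rw [integral_add (integrable_const _)
      (integrable_finsetSum _ fun k _ => integrable_of_continuous (hg k)),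
      integral_finsetSum _ fun k _ => integrable_of_continuous (hg k)]
    have h6 : ∫ v : Metric.sphere (0 : Pt D) 1, r / 2 ^ D ∂(uniformDirection D) = r / 2 ^ D := by
      simp
    set s := Real.sqrt (d / D) with hs
    have hs0 : 0 ≤ s := Real.sqrt_nonneg _
    have h7 : r / 2 ^ D ≤ r * s := by
      rw [div_eq_mul_inv]
      refine mul_le_mul_of_nonneg_left ?_ hr.le
      refine Real.le_sqrt_of_sq_le ?_
      have h8 : (D : ℝ) ≤ 2 ^ D := by exact_mod_cast Nat.lt_two_pow_self.le
      have h9 : (1 : ℝ) ≤ d := by exact_mod_cast hd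
      have h10 : (1 : ℝ) ≤ 2 ^ D := one_le_pow₀ (by norm_num)
      calc (((2 : ℝ) ^ D)⁻¹) ^ 2 ≤ ((2 : ℝ) ^ D)⁻¹ := by
            rw [sq]; exact mul_le_of_le_one_left (by positivity) (inv_le_one_of_one_le₀ h10)
        _ ≤ (D : ℝ)⁻¹ := inv_anti₀ hD h8
        _ ≤ d / D := by rw [← one_div]; gcongr
    have h11 : ∀ k ∈ Finset.range D, ∫ v, g k v ∂(uniformDirection D) ≤
        35 / 4 * r * s * (((k : ℝ) + 1) / 2 ^ k) := by
      intro k _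
      refine (hgi k).trans ?_
      -- `35/24` is a rational bound for `√2`. With `∑ (k+1)/2^k ≤ 4` the links contribute `35 r s`,
      -- and the remainder brings the total to `36 r s`.
      have h12 : Real.sqrt (2 * (d * (k + 1) : ℕ) / D) ≤ 35 / 24 * s * (k + 1) := by
        rw [Real.sqrt_le_left (by positivity)]
        rw [mul_pow, mul_pow, hs, Real.sq_sqrt (by positivity)]
        push_cast
        have h13 : (k : ℝ) + 1 ≤ (k + 1) ^ 2 := by nlinarith [(Nat.cast_nonneg k : (0 : ℝ) ≤ k)]
        have h14 : (0 : ℝ) ≤ d / D := by positivity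
        calc 2 * ((d : ℝ) * (k + 1)) / D = 2 * (d / D) * (k + 1) := by ring
          _ ≤ (35 / 24) ^ 2 * (d / D) * (k + 1) ^ 2 := by
            gcongr
            norm_num
      calc 4 * (3 / 2 * r / 2 ^ k) * Real.sqrt (2 * (d * (k + 1) : ℕ) / D)
          ≤ 4 * (3 / 2 * r / 2 ^ k) * (35 / 24 * s * (k + 1)) := by gcongr
        _ = _ := by ring
    rw [h6]
    calc r / 2 ^ D + ∑ k ∈ Finset.range D, ∫ v, g k v ∂(uniformDirection D)
        ≤ r * s + ∑ k ∈ Finset.range D, 35 / 4 * r * s * (((k : ℝ) + 1) / 2 ^ k) :=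
          add_le_add h7 (Finset.sum_le_sum h11)
      _ ≤ r * s + 35 / 4 * r * s * 4 := by
          rw [← Finset.mul_sum]
          gcongr
          exact sum_range_succ_div_two_pow_le D
      _ = 36 * r * s := by ring

/-! ### The median -/

theorem succ_le_countP_of_sorted {l : List ℝ} (hl : l.SortedLE) {k : ℕ} (hk : k < l.length)
    (P : ℝ → Prop) [DecidablePred P] (hP : ∀ x ≤ l[k], P x) : k + 1 ≤ l.countP P := by
  have h1 : (l.take (k + 1)).countP P = (l.take (k + 1)).length := by
    rw [List.countP_eq_length]
    intro a ha
    obtain ⟨i, hi, rfl⟩ := List.mem_iff_getElem.1 ha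
    rw [List.length_take] at hi
    rw [List.getElem_take]
    exact decide_eq_true (hP _ (hl.getElem_le_getElem_of_le (by omega)))
  have h2 := (List.take_sublist (k + 1) l).countP_le (p := fun x => decide (P x))
  rw [h1, List.length_take] at h2
  omega

theorem length_sub_le_countP_of_sorted {l : List ℝ} (hl : l.SortedLE) {k : ℕ} (hk : k < l.length)
    (P : ℝ → Prop) [DecidablePred P] (hP : ∀ x, l[k] ≤ x → P x) : l.length - k ≤ l.countP P := by
  have h1 : (l.drop k).countP P = (l.drop k).length := by
    rw [List.countP_eq_length]
    intro a ha
    obtain ⟨i, hi, rfl⟩ := List.mem_iff_getElem.1 ha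
    rw [List.length_drop] at hi
    rw [List.getElem_drop]
    exact decide_eq_true (hP _ (hl.getElem_le_getElem_of_le (by omega)))
  have h2 := (List.drop_sublist k l).countP_le (p := fun x => decide (P x))
  rw [h1, List.length_drop] at h2
  exact h2

theorem getElem_le_iff_of_sorted {l : List ℝ} (hl : l.SortedLE) {k : ℕ} (hk : k < l.length)
    (m : ℝ) : l[k] ≤ m ↔ k < l.countP (fun x => x ≤ m) := by
  constructor
  · intro h
    exact succ_le_countP_of_sorted hl hk (fun x => x ≤ m) fun x hx => hx.trans h
  · intro h
    by_contra! hm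
    have h1 := length_sub_le_countP_of_sorted hl hk (fun x => ¬ x ≤ m)
      fun x hx => not_le.2 (hm.trans_le hx)
    have h2 := l.length_eq_countP_add_countP (fun x => decide (x ≤ m))
    simp only [decide_eq_true_eq] at h2
    omega

theorem sortedLE_sort (s : Multiset ℝ) : s.sort.SortedLE :=
  (Multiset.pairwise_sort s (· ≤ ·)).sortedLE

theorem countP_sort (s : Multiset ℝ) (P : ℝ → Prop) [DecidablePred P] :
    s.sort.countP P = s.countP P := by
  conv_rhs => rw [← Multiset.sort_eq s (· ≤ ·)]
  rw [Multiset.coe_countP]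

/-- The upper middle entry is at least the median, so it and everything after it in the sorted list
exceed `m`. -/
theorem card_le_two_mul_countP_of_lt_median {s : Multiset ℝ} {m : ℝ} (hs : 0 < s.card)
    (h : m < median s) : s.card ≤ 2 * s.countP (fun x => m < x) := by
  have hl := sortedLE_sort s
  have hlen : s.sort.length = s.card := Multiset.length_sort _
  have h1 : (s.card - 1) / 2 < s.sort.length := by omega
  have h2 : s.card / 2 < s.sort.length := by omega
  rw [median, List.getD_eq_getElem _ _ h1, List.getD_eq_getElem _ _ h2] at h
  have h3 : s.sort[(s.card - 1) / 2] ≤ s.sort[s.card / 2] :=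
    hl.getElem_le_getElem_of_le (by omega)
  have h4 := length_sub_le_countP_of_sorted hl h2 (fun x => m < x) fun x hx => by linarith
  rw [countP_sort, hlen] at h4
  have h5 : s.card - s.card / 2 ≤ s.countP (fun x => m < x) := h4
  omega

theorem card_le_two_mul_countP_of_median_lt {s : Multiset ℝ} {m : ℝ} (hs : 0 < s.card)
    (h : median s < m) : s.card ≤ 2 * s.countP (fun x => x < m) := by
  have hl := sortedLE_sort s
  have hlen : s.sort.length = s.card := Multiset.length_sort _
  have h1 : (s.card - 1) / 2 < s.sort.length := by omega
  have h2 : s.card / 2 < s.sort.length := by omega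
  rw [median, List.getD_eq_getElem _ _ h1, List.getD_eq_getElem _ _ h2] at h
  have h3 : s.sort[(s.card - 1) / 2] ≤ s.sort[s.card / 2] :=
    hl.getElem_le_getElem_of_le (by omega)
  have h4 := succ_le_countP_of_sorted hl h1 (fun x => x < m) fun x hx => by linarith
  rw [countP_sort] at h4
  omega

theorem countP_map_val {α : Type*} (C : Finset α) (f : α → ℝ) (P : ℝ → Prop) [DecidablePred P] :
    (C.val.map f).countP P = (C.filter fun z => P (f z)).card := by
  rw [Multiset.countP_map]
  rfl

/-- If the median is far from `q`, then so are many of the values, and their average fourth power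
of the distance from `q` is large. -/
theorem one_le_of_lt_abs_median_sub {α : Type*} {C : Finset α} (hC : C.Nonempty) (f : α → ℝ)
    {q t : ℝ} (ht : 0 < t) (h : t < |median (C.val.map f) - q|) :
    1 ≤ 2 / (C.card : ℝ) * ∑ z ∈ C, ((f z - q) / t) ^ 4 := by
  classical
  have hcard : 0 < (C.val.map f).card := by simpa using hC
  have hC0 : (0 : ℝ) < C.card := by exact_mod_cast hC.card_pos
  have key : C.card ≤ 2 * (C.filter fun z => t < |f z - q|).card := by
    rcases lt_abs.1 h with h1 | h1
    · have := card_le_two_mul_countP_of_lt_median (m := q + t) hcard (by linarith)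
      rw [countP_map_val, Multiset.card_map, Finset.card_val] at this
      refine this.trans (Nat.mul_le_mul_left 2 (Finset.card_le_card
        (Finset.monotone_filter_right C fun z _ hz => ?_)))
      exact lt_abs.2 (Or.inl (by linarith))
    · have := card_le_two_mul_countP_of_median_lt (m := q - t) hcard (by linarith)
      rw [countP_map_val, Multiset.card_map, Finset.card_val] at this
      refine this.trans (Nat.mul_le_mul_left 2 (Finset.card_le_card
        (Finset.monotone_filter_right C fun z _ hz => ?_)))
      exact lt_abs.2 (Or.inr (by linarith))
  have h2 : ((C.filter fun z => t < |f z - q|).card : ℝ) ≤ ∑ z ∈ C, ((f z - q) / t) ^ 4 := by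
    rw [Finset.card_eq_sum_ones, Nat.cast_sum, Finset.sum_filter]
    refine Finset.sum_le_sum fun z _ => ?_
    split_ifs with hz
    · have h4 : 1 ≤ |(f z - q) / t| := by
        rw [abs_div, abs_of_pos ht, one_le_div ht]; exact hz.le
      rw [← Even.pow_abs (by decide : Even 4)]
      simpa using one_le_pow₀ h4
    · positivity
  rw [div_mul_eq_mul_div, one_le_div hC0]
  have : (C.card : ℝ) ≤ 2 * ((C.filter fun z => t < |f z - q|).card : ℝ) := by exact_mod_cast key
  linarith

/-- Order statistics are measurable: the `k`-th entry is at most `m` exactly when more than `k` of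
the values are, which is a counting condition. -/
theorem measurable_median {α β : Type*} [MeasurableSpace β] (C : Finset α) (F : α → β → ℝ)
    (hF : ∀ z, Measurable (F z)) : Measurable fun v => median (C.val.map fun z => F z v) := by
  classical
  have key : ∀ k, Measurable fun v => (C.val.map fun z => F z v).sort.getD k 0 := by
    intro k
    rcases lt_or_ge k C.card with hk | hk
    · refine measurable_of_Iic fun m => ?_
      have : (fun v => (C.val.map fun z => F z v).sort.getD k 0) ⁻¹' Set.Iic m =
          {v | k < ∑ z ∈ C, if F z v ≤ m then 1 else 0} := by
        ext v
        have hk' : k < (C.val.map fun z => F z v).sort.length := by simpa using hk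
        rw [Set.mem_preimage, Set.mem_Iic, List.getD_eq_getElem _ _ hk',
          getElem_le_iff_of_sorted (sortedLE_sort _) hk', countP_sort, countP_map_val,
          Finset.card_filter]
        rfl
      rw [this]
      refine measurableSet_lt measurable_const (Finset.measurable_sum _ fun z _ => ?_)
      exact Measurable.ite (measurableSet_le (hF z) measurable_const) measurable_const
        measurable_const
    · have : (fun v => (C.val.map fun z => F z v).sort.getD k 0) = fun _ => 0 := by
        ext v
        exact List.getD_eq_default _ _ (by simpa using hk)
      rw [this]
      exact measurable_const
  simp only [median, Multiset.card_map]
  exact ((key _).add (key _)).div_const _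

theorem measurable_threshold {D : ℕ} (C : Finset (Pt D)) (p : Pt D) :
    Measurable (threshold C p) := by
  refine Measurable.add ?_ (measurable_snd.mul_const _)
  exact measurable_median C (fun z (w : Choice D) => inner ℝ z (w.1 : Pt D))
    fun z => (Continuous.inner continuous_const (continuous_subtype_val.comp continuous_fst)).measurable

/-! ### One random split -/

theorem dist_le_radiusEstimate {D : ℕ} {C : Finset (Pt D)} {p z : Pt D} (hz : z ∈ C) :
    dist p z ≤ radiusEstimate C p := by
  rw [radiusEstimate, ← coe_nndist]
  exact NNReal.coe_le_coe.2 (Finset.le_sup (f := fun y => nndist p y) hz)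

theorem radiusEstimate_le_diam {D : ℕ} {C : Finset (Pt D)} {p : Pt D} (hp : p ∈ C) :
    radiusEstimate C p ≤ Metric.diam (C : Set (Pt D)) := by
  rw [radiusEstimate, ← Real.le_toNNReal_iff_coe_le Metric.diam_nonneg]
  refine Finset.sup_le fun z hz => ?_
  rw [Real.le_toNNReal_iff_coe_le Metric.diam_nonneg, coe_nndist]
  exact Metric.dist_le_diam_of_mem C.finite_toSet.isBounded hp hz

theorem diam_le_two_mul_radiusEstimate {D : ℕ} (C : Finset (Pt D)) (p : Pt D) :
    Metric.diam (C : Set (Pt D)) ≤ 2 * radiusEstimate C p := by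
  refine Metric.diam_le_of_forall_dist_le (by rw [radiusEstimate]; positivity) fun a ha b hb => ?_
  have h1 := dist_triangle_left a b p
  have h2 := dist_le_radiusEstimate (p := p) (Finset.mem_coe.1 ha)
  have h3 := dist_le_radiusEstimate (p := p) (Finset.mem_coe.1 hb)
  linarith

theorem mem_child_true {D : ℕ} {C : Finset (Pt D)} {p : Pt D} {w : Choice D} {z : Pt D} :
    z ∈ child C p w true ↔ z ∈ C ∧ inner ℝ z (w.1 : Pt D) < threshold C p w := by
  simp [child]

theorem mem_child_false {D : ℕ} {C : Finset (Pt D)} {p : Pt D} {w : Choice D} {z : Pt D} :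
    z ∈ child C p w false ↔ z ∈ C ∧ threshold C p w ≤ inner ℝ z (w.1 : Pt D) := by
  simp [child]

theorem child_subset {D : ℕ} (C : Finset (Pt D)) (p : Pt D) (w : Choice D) (b : Bool) :
    child C p w b ⊆ C := by
  cases b <;> exact Finset.filter_subset _ _

theorem measurableSet_mem_child {D : ℕ} (C : Finset (Pt D)) (p z : Pt D) (b : Bool) :
    MeasurableSet {w : Choice D | z ∈ child C p w b} := by
  have hz : Measurable fun w : Choice D => inner ℝ z (w.1 : Pt D) :=
    (Continuous.inner continuous_const (continuous_subtype_val.comp continuous_fst)).measurable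
  cases b
  · simp only [mem_child_false]
    exact (MeasurableSet.const _).inter (measurableSet_le (measurable_threshold C p) hz)
  · simp only [mem_child_true]
    exact (MeasurableSet.const _).inter (measurableSet_lt hz (measurable_threshold C p))

theorem uniformOffset_Icc_le (a b : ℝ) :
    uniformOffset (Set.Icc a b) ≤ ENNReal.ofReal ((b - a) / 2) := by
  rw [uniformOffset, cond_apply measurableSet_Icc, Real.volume_Icc]
  calc (ENNReal.ofReal (1 - -1))⁻¹ * volume (Set.Icc (-1) 1 ∩ Set.Icc a b)
      ≤ (ENNReal.ofReal (1 - -1))⁻¹ * volume (Set.Icc a b) := by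
        gcongr; exact Set.inter_subset_right
    _ = _ := by
        rw [Real.volume_Icc, ← ENNReal.ofReal_inv_of_pos (by norm_num),
          ← ENNReal.ofReal_mul (by norm_num)]
        congr 1; ring

theorem uniformOffset_Icc {a b : ℝ} (ha : -1 ≤ a) (hb : b ≤ 1) :
    uniformOffset (Set.Icc a b) = ENNReal.ofReal ((b - a) / 2) := by
  rw [uniformOffset, cond_apply measurableSet_Icc, Real.volume_Icc,
    Set.inter_eq_right.2 (Set.Icc_subset_Icc ha hb), Real.volume_Icc,
    ← ENNReal.ofReal_inv_of_pos (by norm_num), ← ENNReal.ofReal_mul (by norm_num)]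
  congr 1; ring

/-- A split rarely cuts a small ball of the data. -/
theorem choiceLaw_split_le {D : ℕ} [NeZero D] {S : Set (Pt D)} {d : ℕ} (hd : 0 < d)
    (hS : DoublingBound S d) {C : Finset (Pt D)} {p : Pt D}
    (hdiam : 0 < Metric.diam (C : Set (Pt D))) {A : Finset (Pt D)} (hAC : A ⊆ C) {y : Pt D}
    {r : ℝ} (hr : 0 < r) (hA : (A : Set (Pt D)) ⊆ Metric.closedBall y r ∩ S) :
    choiceLaw D {w | ∀ b, ¬ A ⊆ child C p w b} ≤
      ENNReal.ofReal (12 * r * Real.sqrt d / Metric.diam (C : Set (Pt D))) := by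
  have hD : (0 : ℝ) < D := Nat.cast_pos.2 (Nat.pos_of_ne_zero (NeZero.ne D))
  have hσ : 0 < Real.sqrt D := Real.sqrt_pos.2 hD
  obtain ⟨g, hg, hg0, hgb, hgi⟩ := hS.exists_projection_bound hd y hr
  have hΔ := diam_le_two_mul_radiusEstimate C p
  set Δ := radiusEstimate C p with hΔdef
  have hΔ0 : 0 < Δ := by linarith
  set s := 6 * Δ / Real.sqrt D with hs
  have hs0 : 0 < s := by positivity
  -- If `A` is cut, the threshold lies between the projections of two of its points, and both are
  -- within `g` of the projection of `y`.
  have hsub : {w : Choice D | ∀ b, ¬ A ⊆ child C p w b} ⊆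
      {w | |threshold C p w - inner ℝ y (w.1 : Pt D)| ≤ g w.1} := by
    intro w hw
    have h1 := hw true
    have h2 := hw false
    rw [Finset.not_subset] at h1 h2
    obtain ⟨a, ha, hat⟩ := h1
    obtain ⟨a', ha', haf⟩ := h2
    rw [mem_child_true, not_and, not_lt] at hat
    rw [mem_child_false, not_and, not_le] at haf
    have h3 := hat (hAC ha)
    have h4 := haf (hAC ha')
    have h5 := hgb a (hA ha) w.1
    have h6 := hgb a' (hA ha') w.1
    rw [inner_sub_left, abs_le] at h5 h6
    rw [Set.mem_ofPred_eq, abs_le]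
    constructor <;> linarith
  have hy : Measurable fun w : Choice D => inner ℝ y (w.1 : Pt D) :=
    (Continuous.inner continuous_const (continuous_subtype_val.comp continuous_fst)).measurable
  have hmeas : MeasurableSet {w : Choice D | |threshold C p w - inner ℝ y (w.1 : Pt D)| ≤ g w.1} :=
    measurableSet_le (continuous_abs.measurable.comp ((measurable_threshold C p).sub hy))
      (hg.measurable.comp measurable_fst)
  refine (measure_mono hsub).trans ?_
  rw [choiceLaw, Measure.prod_apply hmeas]
  calc ∫⁻ v, uniformOffset (Prod.mk v ⁻¹'
          {w : Choice D | |threshold C p w - inner ℝ y (w.1 : Pt D)| ≤ g w.1}) ∂(uniformDirection D)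
      ≤ ∫⁻ v, ENNReal.ofReal (g v / s) ∂(uniformDirection D) := by
        refine lintegral_mono fun v => ?_
        set q := inner ℝ y (v : Pt D) - median (C.val.map fun z => inner ℝ z (v : Pt D)) with hq
        refine le_trans (measure_mono (t := Set.Icc ((q - g v) / s) ((q + g v) / s)) ?_)
          ((uniformOffset_Icc_le _ _).trans_eq ?_)
        · intro u hu
          have hu' : |median (C.val.map fun z => inner ℝ z (v : Pt D)) + u * s -
            inner ℝ y (v : Pt D)| ≤ g v := hu
          rw [abs_le] at hu'
          rw [Set.mem_Icc, div_le_iff₀ hs0, le_div_iff₀ hs0]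
          constructor <;> linarith
        · congr 1; field_simp; ring
    _ = ENNReal.ofReal (∫ v, g v / s ∂(uniformDirection D)) := by
        rw [ofReal_integral_eq_lintegral_ofReal
          (integrable_of_continuous (hg.div_const s))
          (Filter.Eventually.of_forall fun v => div_nonneg (hg0 v) hs0.le)]
    _ ≤ _ := by
        refine ENNReal.ofReal_le_ofReal ?_
        rw [integral_div, div_le_iff₀ hs0]
        refine hgi.trans ?_
        rw [Real.sqrt_div' _ hD.le, hs]
        -- Dividing `36 r √(d/D)` by `s = 6Δ/√D` gives `6 r √d / Δ`; this factor trades `Δ` for the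
        -- diameter.
        have h7 : 1 ≤ 2 * Δ / Metric.diam (C : Set (Pt D)) := (one_le_div hdiam).2 hΔ
        calc 36 * r * (Real.sqrt d / Real.sqrt D) = 36 * r * (Real.sqrt d / Real.sqrt D) * 1 := by
              ring
          _ ≤ 36 * r * (Real.sqrt d / Real.sqrt D) * (2 * Δ / Metric.diam (C : Set (Pt D))) := by
              gcongr
          _ = _ := by ring

/-- The split sends the data of the cell in the ball of radius `ρ` about `z₁` to one side, and
those in the ball of radius `ρ` about `z₂` to the other. -/
def Separates {D : ℕ} (C : Finset (Pt D)) (p : Pt D) (ρ : ℝ) (z₁ z₂ : Pt D) (w : Choice D) :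
    Prop :=
  ∃ b, (∀ a ∈ C, dist a z₁ ≤ ρ → a ∈ child C p w b) ∧ ∀ a ∈ C, dist a z₂ ≤ ρ → a ∈ child C p w !b

theorem measurableSet_separates {D : ℕ} (C : Finset (Pt D)) (p : Pt D) (ρ : ℝ) (z₁ z₂ : Pt D) :
    MeasurableSet {w | Separates C p ρ z₁ z₂ w} := by
  have h : ∀ (z : Pt D) (b : Bool),
      MeasurableSet {w : Choice D | ∀ a ∈ C, dist a z ≤ ρ → a ∈ child C p w b} := by
    intro z b
    simp only [Set.ofPred_forall]
    exact Finset.measurableSet_biInter _ fun a _ =>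
      MeasurableSet.iInter fun _ => measurableSet_mem_child C p a b
  simp only [Separates, Set.ofPred_exists]
  exact MeasurableSet.iUnion fun b => (h z₁ b).inter (h z₂ _)

/-- For fixed `v` the threshold is uniform on `[m - s, m + s]`. No order between `lo` and `hi` is
required, because `ENNReal.ofReal` truncates at `0`. -/
theorem le_uniformOffset_threshold {D : ℕ} {C : Finset (Pt D)} {p : Pt D}
    {v : Metric.sphere (0 : Pt D) 1} {s m lo hi : ℝ} (hs : 0 < s)
    (hthr : ∀ u, threshold C p (v, u) = m + u * s) (hlo : m - s ≤ lo) (hhi : hi ≤ m + s)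
    {E : Set ℝ} (hE : ∀ u, lo ≤ threshold C p (v, u) → threshold C p (v, u) ≤ hi → u ∈ E) :
    ENNReal.ofReal ((hi - lo) / (2 * s)) ≤ uniformOffset E := by
  calc ENNReal.ofReal ((hi - lo) / (2 * s))
      = uniformOffset (Set.Icc ((lo - m) / s) ((hi - m) / s)) := by
        rw [uniformOffset_Icc]
        · congr 1; field_simp; ring
        · rw [le_div_iff₀ hs]; linarith
        · rw [div_le_iff₀ hs]; linarith
    _ ≤ _ := by
        refine measure_mono fun u hu => ?_
        rw [Set.mem_Icc, div_le_iff₀ hs, le_div_iff₀ hs] at hu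
        exact hE u (by rw [hthr]; linarith) (by rw [hthr]; linarith)

/-- A direction for which the projections of the two balls are well separated and not far from the
median has a constant chance of separating them. -/
theorem le_uniformOffset_separates {D : ℕ} {C : Finset (Pt D)} {p : Pt D} {ρ : ℝ}
    {z₁ z₂ : Pt D} {v : Metric.sphere (0 : Pt D) 1} {s m x₁ x₂ γ : ℝ} (hs : 0 < s)
    (hthr : ∀ u, threshold C p (v, u) = m + u * s)
    (h₁ : ∀ a ∈ C, dist a z₁ ≤ ρ → |inner ℝ a (v : Pt D) - x₁| < γ)
    (h₂ : ∀ a ∈ C, dist a z₂ ≤ ρ → |inner ℝ a (v : Pt D) - x₂| < γ)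
    (hγ : 0 ≤ γ) (hx₁ : |x₁ - m| ≤ s) (hx₂ : |x₂ - m| ≤ s) :
    ENNReal.ofReal ((|x₁ - x₂| - 2 * γ) / (2 * s)) ≤
      uniformOffset {u | Separates C p ρ z₁ z₂ (v, u)} := by
  rw [abs_le] at hx₁ hx₂
  rcases le_total x₁ x₂ with h | h
  · rw [abs_of_nonpos (by linarith), show -(x₁ - x₂) - 2 * γ = (x₂ - γ) - (x₁ + γ) by ring]
    refine le_uniformOffset_threshold hs hthr (by linarith) (by linarith) fun u hu₁ hu₂ => ?_
    refine ⟨true, fun a ha haz => mem_child_true.2 ⟨ha, ?_⟩,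
      fun a ha haz => mem_child_false.2 ⟨ha, ?_⟩⟩
    · have := (abs_lt.1 (h₁ a ha haz)).2
      simp only
      linarith
    · have := (abs_lt.1 (h₂ a ha haz)).1
      simp only
      linarith
  · rw [abs_of_nonneg (by linarith), show x₁ - x₂ - 2 * γ = (x₁ - γ) - (x₂ + γ) by ring]
    refine le_uniformOffset_threshold hs hthr (by linarith) (by linarith) fun u hu₁ hu₂ => ?_
    refine ⟨false, fun a ha haz => mem_child_false.2 ⟨ha, ?_⟩,
      fun a ha haz => mem_child_true.2 ⟨ha, ?_⟩⟩
    · have := (abs_lt.1 (h₁ a ha haz)).1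
      simp only
      linarith
    · have := (abs_lt.1 (h₂ a ha haz)).2
      simp only
      linarith

theorem integral_inner_div_pow_four_le {D : ℕ} [NeZero D] {x : Pt D} {Δ : ℝ} (hΔ : 0 < Δ)
    (hx : ‖x‖ ≤ Δ) :
    ∫ v, (inner ℝ x (v : Pt D) / (3 * Δ / Real.sqrt D)) ^ 4 ∂(uniformDirection D) ≤ 1 / 27 := by
  have hD : (0 : ℝ) < D := Nat.cast_pos.2 (Nat.pos_of_ne_zero (NeZero.ne D))
  simp_rw [div_pow _ (3 * Δ / Real.sqrt D)]
  have hσ : Real.sqrt D ^ 4 = (D : ℝ) ^ 2 := by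
    rw [show 4 = 2 * 2 by norm_num, pow_mul, Real.sq_sqrt hD.le]
  rw [integral_div, div_le_iff₀ (by positivity), div_pow, hσ]
  have h := integral_inner_pow_le 2 x
  norm_num [Finset.prod_range_succ] at h
  refine h.trans ?_
  calc 3 * (‖x‖ ^ 2 / D) ^ 2 ≤ 3 * (Δ ^ 2 / D) ^ 2 := by gcongr
    _ = _ := by field_simp; ring

/-- A lower bound for the indicator of the directions that are good for separating the balls about
`z₁` and `z₂`: `a₁`, `a₂` are points of the cell in these balls, `Δ` is the radius estimate from
`p`, and `g₁`, `g₂` bound the projections of the balls, which should be less than `τ`. -/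
noncomputable def separationScore {D : ℕ} (C : Finset (Pt D)) (p a₁ a₂ : Pt D) (Δ τ : ℝ)
    (g₁ g₂ : Metric.sphere (0 : Pt D) 1 → ℝ) (v : Metric.sphere (0 : Pt D) 1) : ℝ :=
  2 / 3 * ((inner ℝ (a₁ - a₂) (v : Pt D) / (‖a₁ - a₂‖ / Real.sqrt D)) ^ 2 - 1 / 16) -
    1 / 9 * (inner ℝ (a₁ - a₂) (v : Pt D) / (‖a₁ - a₂‖ / Real.sqrt D)) ^ 4 -
    (inner ℝ (a₁ - p) (v : Pt D) / (3 * Δ / Real.sqrt D)) ^ 4 -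
    (inner ℝ (a₂ - p) (v : Pt D) / (3 * Δ / Real.sqrt D)) ^ 4 -
    2 / (C.card : ℝ) * ∑ z ∈ C, (inner ℝ (z - p) (v : Pt D) / (3 * Δ / Real.sqrt D)) ^ 4 -
    g₁ v / τ - g₂ v / τ

/-- Each subtracted penalty is at least `1` when its bad event occurs, while the leading polynomial
is at most `1` and is nonpositive for `|t| ≤ 1/4`. A positive score therefore excludes every bad
event. -/
theorem separationScore_le {D : ℕ} {C : Finset (Pt D)} {p a₁ a₂ : Pt D} {Δ τ : ℝ}
    {g₁ g₂ : Metric.sphere (0 : Pt D) 1 → ℝ} {v : Metric.sphere (0 : Pt D) 1} (hΔ : 0 < Δ)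
    (hD : 0 < D) (hC : C.Nonempty) (ha : a₁ ≠ a₂) (hτ : 0 < τ) (hg₁ : 0 ≤ g₁ v) (hg₂ : 0 ≤ g₂ v)
    (h : 0 < separationScore C p a₁ a₂ Δ τ g₁ g₂ v) :
    separationScore C p a₁ a₂ Δ τ g₁ g₂ v ≤ 1 ∧
      ‖a₁ - a₂‖ / (4 * Real.sqrt D) ≤ |inner ℝ (a₁ - a₂) (v : Pt D)| ∧
      |inner ℝ (a₁ - p) (v : Pt D)| ≤ 3 * Δ / Real.sqrt D ∧
      |inner ℝ (a₂ - p) (v : Pt D)| ≤ 3 * Δ / Real.sqrt D ∧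
      |median (C.val.map fun z => inner ℝ z (v : Pt D)) - inner ℝ p (v : Pt D)| ≤
        3 * Δ / Real.sqrt D ∧ g₁ v < τ ∧ g₂ v < τ := by
  have hσ : 0 < Real.sqrt D := Real.sqrt_pos.2 (Nat.cast_pos.2 hD)
  have hκ : 0 < 3 * Δ / Real.sqrt D := by positivity
  have hℓ : 0 < ‖a₁ - a₂‖ := norm_pos_iff.2 (sub_ne_zero.2 ha)
  have hpow : ∀ x : ℝ, 3 * Δ / Real.sqrt D < |x| → 1 ≤ (x / (3 * Δ / Real.sqrt D)) ^ 4 := by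
    intro x hx
    rw [← Even.pow_abs (by decide : Even 4)]
    refine one_le_pow₀ ?_
    rw [abs_div, abs_of_pos hκ, one_le_div hκ]
    exact hx.le
  have hmed := fun h' => one_le_of_lt_abs_median_sub hC
    (fun z => inner ℝ z (v : Pt D)) (q := inner ℝ p (v : Pt D)) hκ h'
  simp only [← inner_sub_left] at hmed
  rw [separationScore] at h ⊢
  set t := inner ℝ (a₁ - a₂) (v : Pt D) / (‖a₁ - a₂‖ / Real.sqrt D) with ht
  set T₁ := (inner ℝ (a₁ - p) (v : Pt D) / (3 * Δ / Real.sqrt D)) ^ 4 with hT₁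
  set T₂ := (inner ℝ (a₂ - p) (v : Pt D) / (3 * Δ / Real.sqrt D)) ^ 4 with hT₂
  set T := 2 / (C.card : ℝ) * ∑ z ∈ C, (inner ℝ (z - p) (v : Pt D) / (3 * Δ / Real.sqrt D)) ^ 4
  have hT₁0 : 0 ≤ T₁ := by positivity
  have hT₂0 : 0 ≤ T₂ := by positivity
  have hT0 : 0 ≤ T := mul_nonneg (by positivity) (Finset.sum_nonneg fun z _ => by positivity)
  have hG₁ : 0 ≤ g₁ v / τ := by positivity
  have hG₂ : 0 ≤ g₂ v / τ := by positivity
  -- Completing the square: `t⁴/9 - 2t²/3 + 1 = (t²/3 - 1)²`.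
  have hmain : 2 / 3 * (t ^ 2 - 1 / 16) - 1 / 9 * t ^ 4 ≤ 1 := by
    nlinarith [sq_nonneg (t ^ 2 / 3 - 1)]
  have ht4 : 0 ≤ t ^ 4 := by positivity
  refine ⟨by linarith, ?_, ?_, ?_, ?_, ?_, ?_⟩
  · have h1 : (1 / 4) ^ 2 < t ^ 2 := by linarith
    have h2 : 1 / 4 < |t| := by
      have := sq_lt_sq.1 h1
      rwa [abs_of_pos (by norm_num : (0 : ℝ) < 1 / 4)] at this
    rw [ht, abs_div, abs_of_pos (by positivity : 0 < ‖a₁ - a₂‖ / Real.sqrt D),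
      lt_div_iff₀ (by positivity)] at h2
    refine le_trans (le_of_eq ?_) h2.le
    field_simp
  · by_contra! h'
    linarith [hpow _ h']
  · by_contra! h'
    linarith [hpow _ h']
  · by_contra! h'
    linarith [hmed h']
  · by_contra! h'
    linarith [(one_le_div hτ).2 h']
  · by_contra! h'
    linarith [(one_le_div hτ).2 h']

theorem continuous_separationScore {D : ℕ} (C : Finset (Pt D)) (p a₁ a₂ : Pt D) (Δ τ : ℝ)
    {g₁ g₂ : Metric.sphere (0 : Pt D) 1 → ℝ} (hg₁ : Continuous g₁) (hg₂ : Continuous g₂) :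
    Continuous (separationScore C p a₁ a₂ Δ τ g₁ g₂) := by
  unfold separationScore
  fun_prop

/-- A Paley–Zygmund argument in polynomial form: the normalised second moment is `1` and the fourth
is at most `3`, so the mean, apart from the `g` terms, is at least `2/3 · 15/16 - 3/9 - (1 + 1 +
2)/27 > 1/7`. -/
theorem le_integral_separationScore {D : ℕ} [NeZero D] {C : Finset (Pt D)} {p a₁ a₂ : Pt D}
    {Δ τ : ℝ} {g₁ g₂ : Metric.sphere (0 : Pt D) 1 → ℝ} (hΔ : 0 < Δ) (hC : ∀ z ∈ C, dist p z ≤ Δ)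
    (ha₁ : a₁ ∈ C) (ha₂ : a₂ ∈ C) (ha : a₁ ≠ a₂) (hg₁ : Continuous g₁) (hg₂ : Continuous g₂) :
    1 / 7 - (∫ v, g₁ v ∂(uniformDirection D)) / τ - (∫ v, g₂ v ∂(uniformDirection D)) / τ ≤
      ∫ v, separationScore C p a₁ a₂ Δ τ g₁ g₂ v ∂(uniformDirection D) := by
  have hD : (0 : ℝ) < D := Nat.cast_pos.2 (Nat.pos_of_ne_zero (NeZero.ne D))
  have hσ : 0 < Real.sqrt D := Real.sqrt_pos.2 hD
  have hℓ : 0 < ‖a₁ - a₂‖ := norm_pos_iff.2 (sub_ne_zero.2 ha)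
  have hC0 : (0 : ℝ) < C.card := by exact_mod_cast Finset.card_pos.2 ⟨a₁, ha₁⟩
  have hb : ∀ z ∈ C, ∫ v, (inner ℝ (z - p) (v : Pt D) / (3 * Δ / Real.sqrt D)) ^ 4
      ∂(uniformDirection D) ≤ 1 / 27 := fun z hz =>
    integral_inner_div_pow_four_le hΔ (by rw [← dist_eq_norm, dist_comm]; exact hC z hz)
  have h2 : ∫ v, (inner ℝ (a₁ - a₂) (v : Pt D) / (‖a₁ - a₂‖ / Real.sqrt D)) ^ 2
      ∂(uniformDirection D) = 1 := by
    simp_rw [div_pow _ (‖a₁ - a₂‖ / Real.sqrt D)]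
    rw [integral_div, integral_inner_sq, div_pow, Real.sq_sqrt hD.le]
    exact div_self (by positivity)
  have h4 : ∫ v, (inner ℝ (a₁ - a₂) (v : Pt D) / (‖a₁ - a₂‖ / Real.sqrt D)) ^ 4
      ∂(uniformDirection D) ≤ 3 := by
    have h := integral_inner_div_pow_four_le (D := D) hℓ le_rfl
    have h' : ∀ v : Metric.sphere (0 : Pt D) 1,
        (inner ℝ (a₁ - a₂) (v : Pt D) / (‖a₁ - a₂‖ / Real.sqrt D)) ^ 4 =
          81 * (inner ℝ (a₁ - a₂) (v : Pt D) / (3 * ‖a₁ - a₂‖ / Real.sqrt D)) ^ 4 := by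
      intro v
      rw [mul_div_assoc, mul_comm (3 : ℝ), ← div_div, div_pow _ (3 : ℝ)]
      ring
    simp_rw [h']
    rw [integral_const_mul]
    linarith
  have hs : ∑ z ∈ C, ∫ v, (inner ℝ (z - p) (v : Pt D) / (3 * Δ / Real.sqrt D)) ^ 4
      ∂(uniformDirection D) ≤ (C.card : ℝ) * (1 / 27) := by
    rw [← nsmul_eq_mul]
    exact Finset.sum_le_card_nsmul _ _ _ hb
  have hT : 2 / (C.card : ℝ) * ∑ z ∈ C, ∫ v, (inner ℝ (z - p) (v : Pt D) /
      (3 * Δ / Real.sqrt D)) ^ 4 ∂(uniformDirection D) ≤ 2 / 27 := by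
    calc _ ≤ 2 / (C.card : ℝ) * (C.card * (1 / 27)) := by gcongr
      _ = _ := by field_simp
  have e : ∀ {f : Metric.sphere (0 : Pt D) 1 → ℝ}, Continuous f →
    Integrable f (uniformDirection D) := fun hf => integrable_of_continuous hf
  unfold separationScore
  rw [integral_sub (e (by fun_prop)) (e (by fun_prop)),
    integral_sub (e (by fun_prop)) (e (by fun_prop)),
    integral_sub (e (by fun_prop)) (e (by fun_prop)),
    integral_sub (e (by fun_prop)) (e (by fun_prop)),
    integral_sub (e (by fun_prop)) (e (by fun_prop)),
    integral_sub (e (by fun_prop)) (e (by fun_prop)),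
    integral_const_mul, integral_const_mul, integral_const_mul,
    integral_sub (e (by fun_prop)) (e (by fun_prop)),
    integral_finsetSum _ fun z _ => e (by fun_prop), integral_div, integral_div, integral_div, h2]
  have hone : ∫ v : Metric.sphere (0 : Pt D) 1, (1 : ℝ) ∂(uniformDirection D) = 1 := by
    simp
  rw [hone]
  linarith [hb a₁ ha₁, hb a₂ ha₂]

/-- Two small balls of data that are far apart on the scale of the cell are separated by a split
with a constant probability. -/
theorem le_choiceLaw_separates {D : ℕ} [NeZero D] {S : Set (Pt D)} {d : ℕ} (hd : 0 < d)
    (hS : DoublingBound S d) {C : Finset (Pt D)} (hCS : (C : Set (Pt D)) ⊆ S) {p : Pt D}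
    (hp : p ∈ C) {M ρ : ℝ} (hM : 0 < M) (hdiam : Metric.diam (C : Set (Pt D)) ≤ 2 * M)
    (hρ : 0 < ρ) (hρM : ρ * Real.sqrt d ≤ M / 2 ^ 18) {z₁ z₂ a₁ a₂ : Pt D} (ha₁ : a₁ ∈ C)
    (ha₂ : a₂ ∈ C) (haz₁ : dist a₁ z₁ ≤ ρ) (haz₂ : dist a₂ z₂ ≤ ρ) (hz : M / 2 ≤ dist z₁ z₂) :
    ENNReal.ofReal (1 / 15360) ≤ choiceLaw D {w | Separates C p ρ z₁ z₂ w} := by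
  have hDn : 0 < D := Nat.pos_of_ne_zero (NeZero.ne D)
  have hD : (0 : ℝ) < D := Nat.cast_pos.2 hDn
  have hσ : 0 < Real.sqrt D := Real.sqrt_pos.2 hD
  have hd1 : 1 ≤ Real.sqrt d := Real.one_le_sqrt.2 (by exact_mod_cast hd)
  have hρ' : ρ ≤ M / 2 ^ 18 := (le_mul_of_one_le_right hρ.le hd1).trans hρM
  have hℓ : M / 4 ≤ ‖a₁ - a₂‖ := by
    rw [← dist_eq_norm]
    have h1 := dist_triangle4_left a₁ a₂ z₁ z₂
    norm_num at hρ'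
    linarith
  have hℓ0 : 0 < ‖a₁ - a₂‖ := by linarith
  have ha : a₁ ≠ a₂ := by
    rintro rfl
    simp at hℓ0
  set Δ := radiusEstimate C p with hΔdef
  have hΔM : Δ ≤ 2 * M := (radiusEstimate_le_diam hp).trans hdiam
  have hΔC : ∀ z ∈ C, dist p z ≤ Δ := fun z hz => dist_le_radiusEstimate hz
  have hΔ : 0 < Δ := by
    have h1 := dist_triangle_left a₁ a₂ p
    rw [dist_eq_norm a₁] at h1
    linarith [hΔC _ ha₁, hΔC _ ha₂]
  obtain ⟨g₁, hg₁, hg₁0, hg₁b, hg₁i⟩ := hS.exists_projection_bound hd z₁ hρ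
  obtain ⟨g₂, hg₂, hg₂0, hg₂b, hg₂i⟩ := hS.exists_projection_bound hd z₂ hρ
  -- The projections of `a₁`, `a₂` will differ by at least `M / (16 √D)`. Each ball spreads less
  -- than `2τ` about its `aᵢ`, so half of that gap remains.
  set τ := M / (128 * Real.sqrt D) with hτdef
  have hτ : 0 < τ := by positivity
  have hgτ : 36 * ρ * Real.sqrt (d / D) / τ ≤ 1 / 50 := by
    rw [div_le_iff₀ hτ, Real.sqrt_div' _ hD.le, hτdef]
    calc 36 * ρ * (Real.sqrt d / Real.sqrt D) = 36 * (ρ * Real.sqrt d) / Real.sqrt D := by ring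
      _ ≤ 36 * (M / 2 ^ 18) / Real.sqrt D := by gcongr
      _ = 9 / 2 ^ 16 * (M / Real.sqrt D) := by ring
      _ ≤ 1 / 6400 * (M / Real.sqrt D) :=
        mul_le_mul_of_nonneg_right (by norm_num) (by positivity)
      _ = _ := by field_simp; norm_num
  set F := separationScore C p a₁ a₂ Δ τ g₁ g₂ with hF
  have hFc : Continuous F := continuous_separationScore C p a₁ a₂ Δ τ hg₁ hg₂
  have hFi : 1 / 20 ≤ ∫ v, F v ∂(uniformDirection D) := by
    refine le_trans ?_ (le_integral_separationScore hΔ hΔC ha₁ ha₂ ha hg₁ hg₂)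
    have h1 := div_le_div_of_nonneg_right hg₁i hτ.le
    have h2 := div_le_div_of_nonneg_right hg₂i hτ.le
    linarith
  -- On a good direction the free gap `M / (32 √D)` is at least `1/768` of the threshold range `2 ·
  -- 6Δ/√D ≤ 24 M/√D`, and `F ≤ 1`. With mean at least `1/20` this yields `1/15360`.
  have hpt : ∀ v, ENNReal.ofReal (F v / 768) ≤
      uniformOffset (Prod.mk v ⁻¹' {w | Separates C p ρ z₁ z₂ w}) := by
    intro v
    rcases le_or_gt (F v) 0 with hv | hv
    · rw [ENNReal.ofReal_of_nonpos (by linarith)]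
      exact zero_le
    obtain ⟨hF1, h12, h1p, h2p, hmed, hg₁τ, hg₂τ⟩ :=
      separationScore_le hΔ hDn ⟨p, hp⟩ ha hτ (hg₁0 v) (hg₂0 v) hv
    have hs : 0 < 6 * Δ / Real.sqrt D := by positivity
    rw [inner_sub_left] at h12 h1p h2p
    set m := median (C.val.map fun z => inner ℝ z (v : Pt D)) with hm
    -- Projections are compared with those of `a₁`, `a₂` rather than of the centres: only points of
    -- the cell are known to lie within `Δ` of `p`. Passing through the centre costs a factor `2`.
    have key : ∀ {z a : Pt D} {g : Metric.sphere (0 : Pt D) 1 → ℝ},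
        (∀ a ∈ Metric.closedBall z ρ ∩ S, ∀ v : Metric.sphere (0 : Pt D) 1,
          |inner ℝ (a - z) (v : Pt D)| ≤ g v) → g v < τ → a ∈ C → dist a z ≤ ρ →
        ∀ a' ∈ C, dist a' z ≤ ρ →
          |inner ℝ a' (v : Pt D) - inner ℝ a (v : Pt D)| < 2 * τ := by
      intro z a g hgb hgτ haC haz a' ha'C ha'z
      have h1 := hgb a ⟨haz, hCS haC⟩ v
      have h2 := hgb a' ⟨ha'z, hCS ha'C⟩ v
      rw [inner_sub_left, abs_le] at h1 h2
      rw [abs_lt]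
      constructor <;> linarith
    have hs2 : 6 * Δ / Real.sqrt D = 3 * Δ / Real.sqrt D + 3 * Δ / Real.sqrt D := by ring
    refine le_trans (ENNReal.ofReal_le_ofReal ?_) (le_uniformOffset_separates
      (C := C) (p := p) (v := v) (m := m) (γ := 2 * τ) hs (fun u => rfl)
      (key hg₁b hg₁τ ha₁ haz₁) (key hg₂b hg₂τ ha₂ haz₂) (by positivity) ?_ ?_)
    · rw [le_div_iff₀ (by positivity)]
      calc F v / 768 * (2 * (6 * Δ / Real.sqrt D))
          ≤ 1 / 768 * (2 * (6 * (2 * M) / Real.sqrt D)) := by gcongr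
        _ = (M / 4) / (4 * Real.sqrt D) - 2 * (2 * τ) := by rw [hτdef]; field_simp; norm_num
        _ ≤ ‖a₁ - a₂‖ / (4 * Real.sqrt D) - 2 * (2 * τ) := by gcongr
        _ ≤ _ := by linarith
    · rw [abs_le] at h1p hmed ⊢
      constructor <;> linarith
    · rw [abs_le] at h2p hmed ⊢
      constructor <;> linarith
  rw [choiceLaw, Measure.prod_apply (measurableSet_separates C p ρ z₁ z₂)]
  calc ENNReal.ofReal (1 / 15360)
      ≤ ENNReal.ofReal (∫ v, F v / 768 ∂(uniformDirection D)) := by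
        refine ENNReal.ofReal_le_ofReal ?_
        rw [integral_div]
        linarith
    _ ≤ ∫⁻ v, ENNReal.ofReal (F v / 768) ∂(uniformDirection D) := by
        have hmax : Continuous fun v => max (F v / 768) 0 := (hFc.div_const _).max continuous_const
        refine (ENNReal.ofReal_le_ofReal (integral_mono
          (integrable_of_continuous (hFc.div_const _)) (integrable_of_continuous hmax)
          fun v => le_max_left _ _)).trans ?_
        rw [ofReal_integral_eq_lintegral_ofReal (integrable_of_continuous hmax)
          (Filter.Eventually.of_forall fun v => le_max_right _ _)]
        simp
    _ ≤ _ := lintegral_mono hpt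

/-! ### Integrating over the choice at a node -/

theorem cell_subset {D : ℕ} (S : Finset (Pt D)) (pivot : Node → Finset (Pt D) → Pt D)
    (ω : Node → Choice D) (a : Node) : cell S pivot ω a ⊆ S := by
  induction a with
  | nil => exact subset_rfl
  | cons b a ih => exact (child_subset _ _ _ _).trans ih

theorem cell_congr {D : ℕ} (S : Finset (Pt D)) (pivot : Node → Finset (Pt D) → Pt D)
    {ω ω' : Node → Choice D} (a : Node)
    (h : ∀ a' : Node, a'.length < a.length → ω a' = ω' a') :
    cell S pivot ω a = cell S pivot ω' a := by
  induction a with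
  | nil => rfl
  | cons b a ih =>
    have h1 := ih fun a' ha' => h a' (ha'.trans (by simp))
    rw [cell, cell, h1, h a (by simp)]

theorem cell_update {D : ℕ} (S : Finset (Pt D)) (pivot : Node → Finset (Pt D) → Pt D)
    (ω : Node → Choice D) (a : Node) (w : Choice D) :
    cell S pivot (Function.update ω a w) a = cell S pivot ω a := by
  refine cell_congr S pivot a fun a' ha' => Function.update_of_ne ?_ _ _
  rintro rfl
  exact lt_irrefl _ ha'

theorem measurableSet_child_eq {D : ℕ} (C C' : Finset (Pt D)) (p : Pt D) (b : Bool) :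
    MeasurableSet {w : Choice D | child C p w b = C'} := by
  classical
  have : {w : Choice D | child C p w b = C'} =
      ⋂ z ∈ C ∪ C', {w | z ∈ child C p w b ↔ z ∈ C'} := by
    ext w
    simp only [Set.mem_ofPred_eq, Set.mem_iInter]
    constructor
    · intro h z _
      rw [h]
    · intro h
      ext z
      by_cases hz : z ∈ C ∪ C'
      · exact h z hz
      · rw [Finset.mem_union, not_or] at hz
        exact iff_of_false (fun h' => hz.1 (child_subset _ _ _ _ h')) hz.2
  rw [this]
  refine Finset.measurableSet_biInter _ fun z _ => ?_
  exact (measurableSet_mem_child C p z b).iff (MeasurableSet.const _)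

theorem measurableSet_cell_eq {D : ℕ} (S : Finset (Pt D)) (pivot : Node → Finset (Pt D) → Pt D)
    (a : Node) (C : Finset (Pt D)) :
    MeasurableSet {ω : Node → Choice D | cell S pivot ω a = C} := by
  induction a generalizing C with
  | nil =>
    simp only [cell]
    exact MeasurableSet.const _
  | cons b a ih =>
    have : {ω : Node → Choice D | cell S pivot ω (b :: a) = C} =
        ⋃ C' ∈ S.powerset, {ω | cell S pivot ω a = C'} ∩
          (fun ω : Node → Choice D => ω a) ⁻¹' {w | child C' (pivot a C') w b = C} := by
      ext ω
      simp only [Set.mem_ofPred_eq, Set.mem_iUnion, Set.mem_inter_iff, Set.mem_preimage]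
      constructor
      · intro h
        exact ⟨_, Finset.mem_powerset.2 (cell_subset S pivot ω a), rfl, h⟩
      · rintro ⟨C', _, rfl, h⟩
        exact h
    rw [this]
    exact Finset.measurableSet_biUnion _ fun C' _ => (ih C').inter
      (measurable_pi_apply a (measurableSet_child_eq C' C _ b))

/-- A cell takes only finitely many values, the subsets of `S`, so the function is a finite sum over
them. -/
theorem measurable_comp_cell {D : ℕ} (S : Finset (Pt D)) (pivot : Node → Finset (Pt D) → Pt D)
    (a : Node) {f : Finset (Pt D) → Choice D → ℝ≥0∞} (hf : ∀ C, Measurable (f C)) :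
    Measurable fun q : (Node → Choice D) × Choice D => f (cell S pivot q.1 a) q.2 := by
  classical
  have : (fun q : (Node → Choice D) × Choice D => f (cell S pivot q.1 a) q.2) =
      fun q => ∑ C ∈ S.powerset, if cell S pivot q.1 a = C then f C q.2 else 0 := by
    ext q
    rw [Finset.sum_ite_eq, if_pos (Finset.mem_powerset.2 (cell_subset S pivot q.1 a))]
  rw [this]
  exact Finset.measurable_sum _ fun C _ => Measurable.ite
    (measurable_fst (measurableSet_cell_eq S pivot a C)) ((hf C).comp measurable_snd)
    measurable_const

/-- Resampling one coordinate independently preserves a product measure. As the cell at `a` ignores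
the choice at `a`, this expresses the independence of the two. -/
theorem measurePreserving_update {D : ℕ} [NeZero D] (a : Node) :
    MeasurePreserving (fun q : (Node → Choice D) × Choice D => Function.update q.1 a q.2)
      ((treeLaw D).prod (choiceLaw D)) (treeLaw D) := by
  classical
  have hmeas : Measurable fun q : (Node → Choice D) × Choice D => Function.update q.1 a q.2 := by
    refine measurable_pi_lambda _ fun a' => ?_
    rcases eq_or_ne a' a with rfl | h
    · simpa using measurable_snd
    · simp only [Function.update_of_ne h]
      exact (measurable_pi_apply a').comp measurable_fst
  refine ⟨hmeas, ?_⟩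
  refine Measure.eq_infinitePi _ fun s t ht => ?_
  rw [Measure.map_apply hmeas (MeasurableSet.pi s.countable_toSet fun i _ => ht i)]
  have : (fun q : (Node → Choice D) × Choice D => Function.update q.1 a q.2) ⁻¹'
      Set.pi s t = (Set.pi (s.erase a) t) ×ˢ (if a ∈ s then t a else Set.univ) := by
    ext q
    simp only [Set.mem_preimage, Set.mem_pi, Set.mem_prod, Finset.coe_erase, Set.mem_sdiff,
      Finset.mem_coe, Set.mem_singleton_iff]
    constructor
    · intro h
      refine ⟨fun i hi => by simpa [hi.2] using h i hi.1, ?_⟩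
      split_ifs with has
      · simpa using h a has
      · trivial
    · rintro ⟨h1, h2⟩ i hi
      rcases eq_or_ne i a with rfl | hia
      · simpa [hi] using h2
      · simpa [hia] using h1 i ⟨hi, hia⟩
  rw [this, Measure.prod_prod, treeLaw, Measure.infinitePi_pi _ fun i _ => ht i]
  split_ifs with has
  · rw [mul_comm, Finset.mul_prod_erase s (fun i => choiceLaw D (t i)) has]
  · rw [Finset.erase_eq_of_notMem has, measure_univ, mul_one]

/-- The choice at a node is independent of the cell at the node. -/
theorem lintegral_cell_choice {D : ℕ} [NeZero D] (S : Finset (Pt D))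
    (pivot : Node → Finset (Pt D) → Pt D) (a : Node) {f : Finset (Pt D) → Choice D → ℝ≥0∞}
    (hf : ∀ C, Measurable (f C)) :
    ∫⁻ ω, f (cell S pivot ω a) (ω a) ∂(treeLaw D) =
      ∫⁻ ω, ∫⁻ w, f (cell S pivot ω a) w ∂(choiceLaw D) ∂(treeLaw D) := by
  have h1 : Measurable fun ω : Node → Choice D => f (cell S pivot ω a) (ω a) :=
    (measurable_comp_cell S pivot a hf).comp (measurable_id.prodMk (measurable_pi_apply a))
  rw [← (measurePreserving_update a).lintegral_comp h1]
  simp only [cell_update, Function.update_self]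
  exact lintegral_prod _ (measurable_comp_cell S pivot a hf).aemeasurable

/-! ### A supermartingale argument along the tree -/

/-- The nodes at depth `n`. -/
def nodesAt : ℕ → Finset Node
  | 0 => {[]}
  | n + 1 => (nodesAt n ×ˢ Finset.univ).map ⟨fun q : Node × Bool => q.2 :: q.1, by
      rintro ⟨a, b⟩ ⟨a', b'⟩ h
      simp only [List.cons.injEq] at h
      rw [h.1, h.2]⟩

theorem sum_nodesAt_succ {M : Type*} [AddCommMonoid M] (n : ℕ) (f : Node → M) :
    ∑ a ∈ nodesAt (n + 1), f a = ∑ a ∈ nodesAt n, ∑ b, f (b :: a) := by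
  rw [nodesAt, Finset.sum_map, Finset.sum_product]
  rfl

theorem cons_mem_nodesAt {n : ℕ} {a : Node} (ha : a ∈ nodesAt n) (b : Bool) :
    b :: a ∈ nodesAt (n + 1) := by
  rw [nodesAt, Finset.mem_map]
  exact ⟨(a, b), Finset.mem_product.2 ⟨ha, Finset.mem_univ _⟩, rfl⟩

open Classical in
/-- Suppose that, as long as a cell is active, the expected potential of its active children is
smaller than its own potential by at least the probability of splitting `A`. Then the potential of
the root bounds the probability that no inactive cell contains `A`. -/
theorem treeLaw_forall_active_le {D : ℕ} [NeZero D] (S : Finset (Pt D))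
    (pivot : Node → Finset (Pt D) → Pt D) {A : Finset (Pt D)} (hA : A ⊆ S)
    (active : Finset (Pt D) → Prop)
    (hactive : ∀ C C' : Finset (Pt D), C' ⊆ C → active C' → active C)
    (Φ q : Finset (Pt D) → ℝ≥0∞) {q₀ : ℝ≥0∞} (hq₀ : q₀ ≠ 0) (hq₀' : q₀ ≠ ⊤)
    (hq : ∀ C ⊆ S, active C → q₀ ≤ q C)
    (hsplit : ∀ (a : Node), ∀ C ⊆ S, active C →
      choiceLaw D {w | ∀ b, ¬ A ⊆ child C (pivot a C) w b} ≤ q C)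
    (hdrift : ∀ (a : Node), ∀ C ⊆ S, active C →
      ∫⁻ w, ∑ b, (if active (child C (pivot a C) w b) then Φ (child C (pivot a C) w b) else 0)
        ∂(choiceLaw D) + q C ≤ Φ C)
    (hΦ : Φ S ≠ ⊤) :
    treeLaw D {ω | ∀ a, A ⊆ cell S pivot ω a → active (cell S pivot ω a)} ≤ Φ S := by
  set c : (Node → Choice D) → Node → Finset (Pt D) := fun ω a => cell S pivot ω a with hc
  -- `W a` is the expected potential held at node `a`, and `T a` the expected cost charged there.
  -- The drift gives `∑ b, W (b :: a) + T a ≤ W a`, which telescopes over depths to bound all costs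
  -- by `Φ S`.
  let W : Node → ℝ≥0∞ := fun a => ∫⁻ ω, (if active (c ω a) then Φ (c ω a) else 0) ∂(treeLaw D)
  let T : Node → ℝ≥0∞ := fun a => ∫⁻ ω, (if active (c ω a) then q (c ω a) else 0) ∂(treeLaw D)
  have hmeas : ∀ (a : Node) (F : Finset (Pt D) → ℝ≥0∞), Measurable fun ω => F (c ω a) :=
    fun a F => (measurable_comp_cell S pivot a (f := fun C _ => F C)
      fun C => measurable_const).comp (measurable_id.prodMk (measurable_pi_apply a))
  have hchild : ∀ (C : Finset (Pt D)) (p : Pt D) (F : Finset (Pt D) → ℝ≥0∞) (b : Bool),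
      Measurable fun w : Choice D => F (child C p w b) := by
    intro C p F b
    have : (fun w : Choice D => F (child C p w b)) =
        fun w => ∑ C' ∈ C.powerset, if child C p w b = C' then F C' else 0 := by
      ext w
      rw [Finset.sum_ite_eq, if_pos (Finset.mem_powerset.2 (child_subset C p w b))]
    rw [this]
    exact Finset.measurable_sum _ fun C' _ => Measurable.ite (measurableSet_child_eq C C' p b)
      measurable_const measurable_const
  have hstep : ∀ a, ∑ b, W (b :: a) + T a ≤ W a := by
    intro a
    let f : Finset (Pt D) → Choice D → ℝ≥0∞ := fun C w =>
      ∑ b, if active (child C (pivot a C) w b) then Φ (child C (pivot a C) w b) else 0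
    have hf : ∀ C, Measurable (f C) := fun C => Finset.measurable_sum _ fun b _ =>
      hchild C (pivot a C) (fun C' => if active C' then Φ C' else 0) b
    have h1 : ∑ b, W (b :: a) = ∫⁻ ω, f (c ω a) (ω a) ∂(treeLaw D) := by
      rw [← lintegral_finsetSum _ fun b _ => hmeas (b :: a) fun C => if active C then Φ C else 0]
      rfl
    rw [h1, lintegral_cell_choice S pivot a hf,
      ← lintegral_add_right _ (hmeas a fun C => if active C then q C else 0)]
    refine lintegral_mono fun ω => ?_
    by_cases ha : active (c ω a)
    · simp only [if_pos ha]
      exact hdrift a _ (cell_subset S pivot ω a) ha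
    · have : ∀ w, f (c ω a) w = 0 := fun w => Finset.sum_eq_zero fun b _ =>
        if_neg fun h => ha (hactive _ _ (child_subset _ _ _ _) h)
      change (∫⁻ w, f (c ω a) w ∂choiceLaw D) + (if active (c ω a) then q (c ω a) else 0) ≤ _
      rw [lintegral_congr this, if_neg ha, lintegral_zero, zero_add]
      exact zero_le
  have hsum : ∀ n, ∑ k ∈ Finset.range n, ∑ a ∈ nodesAt k, T a + ∑ a ∈ nodesAt n, W a ≤ Φ S := by
    intro n
    induction n with
    | zero =>
      simp only [Finset.range_zero, Finset.sum_empty, zero_add, nodesAt, Finset.sum_singleton]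
      calc W [] ≤ ∫⁻ _, Φ S ∂(treeLaw D) := lintegral_mono fun ω => by
            change (if active S then Φ S else 0) ≤ Φ S
            split_ifs <;> simp
        _ = Φ S := by simp
    | succ n ih =>
      refine le_trans ?_ ih
      rw [Finset.sum_range_succ, sum_nodesAt_succ, add_assoc, ← Finset.sum_add_distrib]
      gcongr with a ha
      rw [add_comm]
      exact hstep a
  have htsum : ∑' n, ∑ a ∈ nodesAt n, T a ≤ Φ S :=
    ENNReal.tsum_le_of_sum_range_le fun n => le_self_add.trans (hsum n)
  -- Markov's inequality. Because `q` is bounded below by `q₀`, summability of the costs forces the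
  -- chance of an active cell at depth `n` to tend to `0`.
  have hact : ∀ a, treeLaw D {ω | active (c ω a)} ≤ T a / q₀ := by
    intro a
    refine (measure_mono fun ω hω => ?_).trans (meas_ge_le_lintegral_div
      (hmeas a fun C => if active C then q C else 0).aemeasurable hq₀ hq₀')
    have hω' : active (c ω a) := hω
    rw [Set.mem_ofPred_eq, if_pos hω']
    exact hq _ (cell_subset S pivot ω a) hω'
  have hcut : ∀ a, treeLaw D {ω | active (c ω a) ∧
      ∀ b, ¬ A ⊆ child (c ω a) (pivot a (c ω a)) (ω a) b} ≤ T a := by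
    intro a
    let f : Finset (Pt D) → Choice D → ℝ≥0∞ := fun C => if active C then
      Set.indicator {w | ∀ b, ¬ A ⊆ child C (pivot a C) w b} 1 else 0
    have hm : ∀ C, MeasurableSet {w : Choice D | ∀ b, ¬ A ⊆ child C (pivot a C) w b} := by
      intro C
      have : {w : Choice D | ∀ b, ¬ A ⊆ child C (pivot a C) w b} =
          ⋂ b, (⋂ z ∈ A, {w : Choice D | z ∈ child C (pivot a C) w b})ᶜ := by
        ext w
        simp [Finset.subset_iff]
      rw [this]
      exact MeasurableSet.iInter fun b => MeasurableSet.compl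
        (Finset.measurableSet_biInter _ fun z _ => measurableSet_mem_child C _ z b)
    have hf : ∀ C, Measurable (f C) := by
      intro C
      by_cases h : active C
      · simp only [f, if_pos h]
        exact measurable_one.indicator (hm C)
      · simp only [f, if_neg h]
        exact measurable_const
    calc _ ≤ ∫⁻ ω, f (c ω a) (ω a) ∂(treeLaw D) := by
          refine meas_le_lintegral₀ ((measurable_comp_cell S pivot a hf).comp
            (measurable_id.prodMk (measurable_pi_apply a))).aemeasurable fun ω hω => ?_
          change 1 ≤ f (c ω a) (ω a)
          simp only [f]
          rw [if_pos hω.1, Set.indicator_of_mem (show ω a ∈ {w | ∀ b, ¬ A ⊆ child (c ω a)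
            (pivot a (c ω a)) w b} from hω.2)]
          rfl
      _ = _ := lintegral_cell_choice S pivot a hf
      _ ≤ T a := by
          refine lintegral_mono fun ω => ?_
          change ∫⁻ w, f (c ω a) w ∂choiceLaw D ≤ if active (c ω a) then q (c ω a) else 0
          by_cases h : active (c ω a)
          · rw [if_pos h]
            simp only [f, if_pos h]
            rw [lintegral_indicator_one (hm _)]
            exact hsplit a _ (cell_subset S pivot ω a) h
          · simp [f, if_neg h]
  -- If `A` is never cut at an active cell, it can be followed down to a cell at depth `n`, which
  -- must still be active.
  have hcover : ∀ n, {ω | ∀ a, A ⊆ c ω a → active (c ω a)} ⊆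
      (⋃ k, ⋃ a ∈ nodesAt k, {ω | active (c ω a) ∧
        ∀ b, ¬ A ⊆ child (c ω a) (pivot a (c ω a)) (ω a) b}) ∪
        ⋃ a ∈ nodesAt n, {ω | active (c ω a)} := by
    intro n ω hω
    rw [Set.mem_union]
    by_contra! hcon
    simp only [Set.mem_iUnion, Set.mem_ofPred_eq, not_exists, not_and, not_forall, not_not] at hcon
    have hex : ∀ n, ∃ a ∈ nodesAt n, A ⊆ c ω a := by
      intro n
      induction n with
      | zero => exact ⟨[], by simp [nodesAt], hA⟩
      | succ n ih =>
        obtain ⟨a, ha, hAa⟩ := ih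
        obtain ⟨b, hb⟩ := hcon.1 n a ha (hω a hAa)
        exact ⟨b :: a, cons_mem_nodesAt ha b, hb⟩
    obtain ⟨a, ha, hAa⟩ := hex n
    exact hcon.2 a ha (hω a hAa)
  have hbound : ∀ n, treeLaw D {ω | ∀ a, A ⊆ c ω a → active (c ω a)} ≤
      Φ S + (∑ a ∈ nodesAt n, T a) / q₀ := by
    intro n
    refine (measure_mono (hcover n)).trans ((measure_union_le _ _).trans (add_le_add ?_ ?_))
    · refine (measure_iUnion_le _).trans (le_trans (ENNReal.tsum_le_tsum fun k => ?_) htsum)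
      exact (measure_biUnion_finset_le _ _).trans (Finset.sum_le_sum fun a _ => hcut a)
    · refine (measure_biUnion_finset_le _ _).trans ?_
      rw [div_eq_mul_inv, Finset.sum_mul]
      exact Finset.sum_le_sum fun a _ => hact a
  have hlim : Filter.Tendsto (fun n => Φ S + (∑ a ∈ nodesAt n, T a) / q₀) Filter.atTop
      (nhds (Φ S + 0 / q₀)) := by
    refine Filter.Tendsto.const_add _ (ENNReal.Tendsto.div_const ?_ (Or.inr hq₀))
    exact ENNReal.tendsto_atTop_zero_of_tsum_ne_top (ne_top_of_le_ne_top hΦ htsum)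
  rw [ENNReal.zero_div, add_zero] at hlim
  exact ge_of_tendsto' hlim hbound

/-! ### The potential of a cell -/

/-- `1 + log n`, and `0` for `n = 0`. -/
noncomputable def logPotential (n : ℕ) : ℝ := if n = 0 then 0 else 1 + Real.log n

theorem logPotential_nonneg (n : ℕ) : 0 ≤ logPotential n := by
  rw [logPotential]
  split_ifs with h
  · exact le_rfl
  · have := Real.log_natCast_nonneg n
    linarith

theorem logPotential_mono {m n : ℕ} (h : m ≤ n) : logPotential m ≤ logPotential n := by
  rcases Nat.eq_zero_or_pos m with rfl | hm
  · simpa [logPotential] using logPotential_nonneg n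
  · have hn : 0 < n := hm.trans_le h
    rw [logPotential, logPotential, if_neg hm.ne', if_neg hn.ne']
    gcongr

/-- This is `log (m/n) ≤ m/n - 1`. The added `1` in `logPotential` covers `m = 0`, when all pairs
die at once. -/
theorem logPotential_add_le {m n k : ℕ} (hn : 0 < n) (h : m + k ≤ n) :
    logPotential m + k / n ≤ logPotential n := by
  have hn' : (0 : ℝ) < n := Nat.cast_pos.2 hn
  have h' : (m : ℝ) + k ≤ n := by exact_mod_cast h
  have hk : (k : ℝ) / n ≤ 1 - m / n := by
    rw [div_le_iff₀ hn', sub_mul, div_mul_cancel₀ _ hn'.ne']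
    linarith
  refine (add_le_add_right hk _).trans ?_
  rw [logPotential, logPotential, if_neg hn.ne']
  split_ifs with hm
  · have := Real.log_natCast_nonneg n
    simp [hm, this]
  · have hm' : (0 : ℝ) < m := Nat.cast_pos.2 (Nat.pos_of_ne_zero hm)
    have := Real.log_le_sub_one_of_pos (div_pos hm' hn')
    rw [Real.log_div hm'.ne' hn'.ne'] at this
    linarith

open Classical in
/-- The pairs of `Z` for which the balls of radius `ρ` about both members meet the cell `C`. -/
noncomputable def livePairs {D : ℕ} (Z : Finset (Pt D × Pt D)) (ρ : ℝ) (C : Finset (Pt D)) :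
    Finset (Pt D × Pt D) :=
  Z.filter fun q => (∃ a ∈ C, dist a q.1 ≤ ρ) ∧ ∃ a ∈ C, dist a q.2 ≤ ρ

theorem livePairs_mono {D : ℕ} (Z : Finset (Pt D × Pt D)) (ρ : ℝ) {C C' : Finset (Pt D)}
    (h : C' ⊆ C) : livePairs Z ρ C' ⊆ livePairs Z ρ C := by
  intro q hq
  simp only [livePairs, Finset.mem_filter] at hq ⊢
  obtain ⟨hqZ, ⟨a, ha, haq⟩, ⟨a', ha', haq'⟩⟩ := hq
  exact ⟨hqZ, ⟨a, h ha, haq⟩, ⟨a', h ha', haq'⟩⟩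

theorem disjoint_child {D : ℕ} {C : Finset (Pt D)} {p z : Pt D} {w : Choice D} {b : Bool}
    (h : z ∈ child C p w b) (h' : z ∈ child C p w !b) : False := by
  cases b
  · exact absurd (mem_child_true.1 h').2 (not_lt.2 (mem_child_false.1 h).2)
  · exact absurd (mem_child_true.1 h).2 (not_lt.2 (mem_child_false.1 h').2)

open Classical in
-- A separated pair has each of its two balls missing from one child, so it is live in neither
-- child.
theorem card_livePairs_child_add_le {D : ℕ} (Z : Finset (Pt D × Pt D)) (ρ : ℝ) (C : Finset (Pt D))
    (p : Pt D) (w : Choice D) (b : Bool) :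
    (livePairs Z ρ (child C p w b)).card +
      ((livePairs Z ρ C).filter fun q => Separates C p ρ q.1 q.2 w).card ≤
        (livePairs Z ρ C).card := by
  rw [← Finset.card_union_of_disjoint]
  · exact Finset.card_le_card (Finset.union_subset (livePairs_mono Z ρ (child_subset C p w b))
      (Finset.filter_subset _ _))
  · rw [Finset.disjoint_left]
    intro q hq hq'
    obtain ⟨b', h1, h2⟩ := (Finset.mem_filter.1 hq').2
    simp only [livePairs, Finset.mem_filter] at hq
    obtain ⟨_, ⟨a, ha, haq⟩, ⟨a', ha', haq'⟩⟩ := hq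
    have k1 := h1 a (child_subset _ _ _ _ ha) haq
    have k2 := h2 a' (child_subset _ _ _ _ ha') haq'
    rcases Bool.eq_or_eq_not b b' with rfl | rfl
    · exact disjoint_child ha' k2
    · exact disjoint_child k1 ha

/-- The potential of a cell: the sum over the scales `j < J` of `Λ j` times the logarithm of the
number of live pairs. -/
noncomputable def potential {D : ℕ} (J : ℕ) (Λ : ℕ → ℝ) (Z : ℕ → Finset (Pt D × Pt D)) (ρ : ℕ → ℝ)
    (C : Finset (Pt D)) : ℝ :=
  ∑ j ∈ Finset.range J, Λ j * logPotential (livePairs (Z j) (ρ j) C).card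

open Classical in
theorem potential_child_add_le {D : ℕ} {J : ℕ} {Λ : ℕ → ℝ} (hΛ : ∀ j, 0 ≤ Λ j)
    (Z : ℕ → Finset (Pt D × Pt D)) (ρ : ℕ → ℝ) (C : Finset (Pt D)) (p : Pt D) (w : Choice D)
    (b : Bool) {j : ℕ} (hj : j < J) (hlive : 0 < (livePairs (Z j) (ρ j) C).card) :
    potential J Λ Z ρ (child C p w b) + Λ j * (((livePairs (Z j) (ρ j) C).filter
      fun q => Separates C p (ρ j) q.1 q.2 w).card / (livePairs (Z j) (ρ j) C).card) ≤
        potential J Λ Z ρ C := by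
  rw [potential, potential, ← Finset.add_sum_erase _ _ (Finset.mem_range.2 hj),
    ← Finset.add_sum_erase (Finset.range J)
      (fun j => Λ j * logPotential (livePairs (Z j) (ρ j) C).card) (Finset.mem_range.2 hj),
    add_right_comm, ← mul_add]
  refine add_le_add (mul_le_mul_of_nonneg_left (logPotential_add_le hlive
    (card_livePairs_child_add_le _ _ _ _ _ _)) (hΛ j)) (Finset.sum_le_sum fun i _ => ?_)
  exact mul_le_mul_of_nonneg_left (logPotential_mono (Finset.card_le_card
    (livePairs_mono _ _ (child_subset C p w b)))) (hΛ i)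

open Classical in
-- The drop at scale `j` is at least `Λ j` times the fraction of live pairs separated, whose mean is
-- at least `κ`; the other scales never increase. Since at most one child is active, the sum over
-- children has at most one nonzero term.
theorem lintegral_potential_child_add_le {D : ℕ} [NeZero D] {J : ℕ} {Λ : ℕ → ℝ}
    (hΛ : ∀ j, 0 ≤ Λ j) (Z : ℕ → Finset (Pt D × Pt D)) (ρ : ℕ → ℝ) {C : Finset (Pt D)}
    {p : Pt D} {j : ℕ} (hj : j < J) (hlive : 0 < (livePairs (Z j) (ρ j) C).card)
    {κ : ℝ} (hsep : ∀ q ∈ livePairs (Z j) (ρ j) C,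
      ENNReal.ofReal κ ≤ choiceLaw D {w | Separates C p (ρ j) q.1 q.2 w})
    (active : Finset (Pt D) → Prop)
    (hactive : ∀ w, ¬ (active (child C p w true) ∧ active (child C p w false))) :
    ∫⁻ w, ∑ b, (if active (child C p w b) then
        ENNReal.ofReal (potential J Λ Z ρ (child C p w b)) else 0) ∂(choiceLaw D) +
      ENNReal.ofReal (Λ j * κ) ≤ ENNReal.ofReal (potential J Λ Z ρ C) := by
  set L := livePairs (Z j) (ρ j) C with hL
  have hL0 : (0 : ℝ) < L.card := Nat.cast_pos.2 hlive
  have hpot : ∀ C', 0 ≤ potential J Λ Z ρ C' := fun C' =>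
    Finset.sum_nonneg fun i _ => mul_nonneg (hΛ i) (logPotential_nonneg _)
  let e : Choice D → ℝ≥0∞ := fun w =>
    ENNReal.ofReal (Λ j * ((L.filter fun q => Separates C p (ρ j) q.1 q.2 w).card / L.card))
  have he : ∀ w, e w = ENNReal.ofReal (Λ j / L.card) *
      ∑ q ∈ L, Set.indicator {w | Separates C p (ρ j) q.1 q.2 w} (fun _ => 1) w := by
    intro w
    simp only [e]
    rw [mul_div_assoc', mul_div_right_comm, ENNReal.ofReal_mul (div_nonneg (hΛ j) hL0.le),
      ENNReal.ofReal_natCast, Finset.card_filter, Nat.cast_sum]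
    congr 1
    refine Finset.sum_congr rfl fun q _ => ?_
    by_cases h : Separates C p (ρ j) q.1 q.2 w <;> simp [h]
  have hint : ENNReal.ofReal (Λ j * κ) ≤ ∫⁻ w, e w ∂(choiceLaw D) := by
    simp_rw [he]
    rw [lintegral_const_mul _ (Finset.measurable_sum _ fun q _ =>
      measurable_const.indicator (measurableSet_separates C p _ _ _)),
      lintegral_finsetSum _ fun q _ =>
        measurable_const.indicator (measurableSet_separates C p _ _ _)]
    calc ENNReal.ofReal (Λ j * κ)
        = ENNReal.ofReal (Λ j / L.card) * ∑ q ∈ L, ENNReal.ofReal κ := by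
          rw [Finset.sum_const, nsmul_eq_mul, ← ENNReal.ofReal_natCast,
            ← ENNReal.ofReal_mul (Nat.cast_nonneg _),
            ← ENNReal.ofReal_mul (div_nonneg (hΛ j) hL0.le)]
          congr 1
          field_simp
      _ ≤ _ := by
          gcongr with q hq
          rw [lintegral_indicator_const (measurableSet_separates C p _ _ _), one_mul]
          exact hsep q hq
  have hpt : ∀ w, ∑ b, (if active (child C p w b) then
      ENNReal.ofReal (potential J Λ Z ρ (child C p w b)) else 0) + e w ≤
        ENNReal.ofReal (potential J Λ Z ρ C) := by
    intro w
    have hb : ∀ b, ENNReal.ofReal (potential J Λ Z ρ (child C p w b)) + e w ≤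
        ENNReal.ofReal (potential J Λ Z ρ C) := by
      intro b
      rw [← ENNReal.ofReal_add (hpot _) (mul_nonneg (hΛ j) (by positivity))]
      exact ENNReal.ofReal_le_ofReal (potential_child_add_le hΛ Z ρ C p w b hj hlive)
    rw [Fintype.sum_bool]
    by_cases h1 : active (child C p w true)
    · have h2 : ¬ active (child C p w false) := fun h => hactive w ⟨h1, h⟩
      rw [if_pos h1, if_neg h2, add_zero]
      exact hb true
    · rw [if_neg h1, zero_add]
      refine le_trans ?_ (hb false)
      gcongr
      split_ifs <;> simp
  calc _ ≤ _ := add_le_add_right hint _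
    _ ≤ _ := le_lintegral_add _ _
    _ ≤ ∫⁻ _, ENNReal.ofReal (potential J Λ Z ρ C) ∂(choiceLaw D) := lintegral_mono hpt
    _ = _ := by simp

/-! ### Reaching a small cell -/

theorem exists_scale {M x : ℝ} {J : ℕ} (h : M < x) (hJ : x ≤ M * 2 ^ J) :
    ∃ j < J, M * 2 ^ j < x ∧ x ≤ 2 * (M * 2 ^ j) := by
  induction J with
  | zero =>
    rw [pow_zero, mul_one] at hJ
    linarith
  | succ J ih =>
    rcases lt_or_ge (M * 2 ^ J) x with h1 | h1
    · exact ⟨J, Nat.lt_succ_self J, h1, hJ.trans_eq (by ring)⟩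
    · obtain ⟨j, hj, h2⟩ := ih h1
      exact ⟨j, hj.trans (Nat.lt_succ_self J), h2⟩

theorem sum_inv_two_pow_le (J : ℕ) : ∑ j ∈ Finset.range J, ((2 : ℝ) ^ j)⁻¹ ≤ 2 := by
  have := sum_geometric_two_le J
  simpa using this

open Classical in
/-- The probability that no cell of diameter at most `M` contains all the data in `B(y, r)`. -/
theorem treeLaw_forall_lt_diam_le {D : ℕ} [NeZero D] {d : ℕ} (hd : 0 < d) {S : Finset (Pt D)}
    (hS : DoublingBound (S : Set (Pt D)) d) (pivot : Node → Finset (Pt D) → Pt D)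
    (hpivot : ∀ (a : Node) (C : Finset (Pt D)), C.Nonempty → pivot a C ∈ C) {y : Pt D}
    (hy : y ∈ S) {r M : ℝ} (hr : 0 < r) (hM : 0 < M) {m : ℕ}
    (hm : 2 ^ 19 * Real.sqrt d ≤ 2 ^ m) :
    treeLaw D {ω | ∀ a, (S.filter fun z => dist z y ≤ r) ⊆ cell S pivot ω a →
        M < Metric.diam (cell S pivot ω a : Set (Pt D))} ≤
      ENNReal.ofReal (24 * 15360 * (1 + 2 * d * m * Real.log 2) * r * Real.sqrt d / M) := by
  set A := S.filter fun z => dist z y ≤ r with hAdef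
  have hyA : y ∈ A := Finset.mem_filter.2 ⟨hy, by simpa using hr.le⟩
  have hAS : A ⊆ S := Finset.filter_subset _ _
  have hd1 : 1 ≤ Real.sqrt d := Real.one_le_sqrt.2 (by exact_mod_cast hd)
  obtain ⟨J, hJ⟩ : ∃ J : ℕ, Metric.diam (S : Set (Pt D)) ≤ M * 2 ^ J := by
    obtain ⟨J, hJ⟩ := pow_unbounded_of_one_lt (Metric.diam (S : Set (Pt D)) / M)
      (by norm_num : (1 : ℝ) < 2)
    exact ⟨J, by rw [div_lt_iff₀ hM] at hJ; linarith⟩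
  -- Nets about `y` alone suffice: an active cell contains `y`, so at scale `j` it lies in `B(y, 2 M
  -- 2^j)`.
  have hnet : ∀ j : ℕ, ∃ T : Finset (Pt D), T.card ≤ 2 ^ (d * m) ∧
      Metric.closedBall y (2 * (M * 2 ^ j)) ∩ S ⊆
        ⋃ c ∈ T, Metric.closedBall c (2 * (M * 2 ^ j) / 2 ^ m) := by
    intro j
    obtain ⟨T, -, hT, hcov⟩ := hS.exists_nets y (2 * (M * 2 ^ j))
    exact ⟨T m, hT m, hcov m⟩
  choose T hTcard hTcov using hnet
  set ρ : ℕ → ℝ := fun j => 2 * (M * 2 ^ j) / 2 ^ m with hρ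
  have hρ0 : ∀ j, 0 < ρ j := fun j => by positivity
  have hρM : ∀ j, ρ j * Real.sqrt d ≤ M * 2 ^ j / 2 ^ 18 := by
    intro j
    simp only [hρ]
    rw [div_mul_eq_mul_div, div_le_div_iff₀ (by positivity) (by positivity)]
    calc 2 * (M * 2 ^ j) * Real.sqrt d * 2 ^ 18 = M * 2 ^ j * (2 ^ 19 * Real.sqrt d) := by ring
      _ ≤ _ := by gcongr
  let Z : ℕ → Finset (Pt D × Pt D) := fun j =>
    (T j ×ˢ T j).filter fun q => M * 2 ^ j / 2 ≤ dist q.1 q.2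
  -- The weight is chosen so that `Λ j / 15360` dominates the probability of cutting `A` at scale
  -- `j`.
  let Λ : ℕ → ℝ := fun j => 15360 * (12 * r * Real.sqrt d / (M * 2 ^ j))
  have hΛ : ∀ j, 0 ≤ Λ j := fun j => by positivity
  let active : Finset (Pt D) → Prop := fun C => A ⊆ C ∧ M < Metric.diam (C : Set (Pt D))
  have hdiam_mono : ∀ C C' : Finset (Pt D), C' ⊆ C →
      Metric.diam (C' : Set (Pt D)) ≤ Metric.diam (C : Set (Pt D)) := fun C C' h =>
    Metric.diam_mono (Finset.coe_subset.2 h) C.finite_toSet.isBounded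
  have hset : {ω | ∀ a, A ⊆ cell S pivot ω a → M < Metric.diam (cell S pivot ω a : Set (Pt D))} =
      {ω | ∀ a, A ⊆ cell S pivot ω a → active (cell S pivot ω a)} := by
    ext ω
    exact forall_congr' fun a => ⟨fun h hA => ⟨hA, h hA⟩, fun h hA => (h hA).2⟩
  have hlive : ∀ C ⊆ S, active C → ∃ j < J, M * 2 ^ j < Metric.diam (C : Set (Pt D)) ∧
      Metric.diam (C : Set (Pt D)) ≤ 2 * (M * 2 ^ j) ∧
        0 < (livePairs (Z j) (ρ j) C).card := by
    intro C hC hact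
    obtain ⟨j, hj, h1, h2⟩ := exists_scale hact.2 ((hdiam_mono _ _ hC).trans hJ)
    refine ⟨j, hj, h1, h2, ?_⟩
    have hcov : ∀ a ∈ C, ∃ c ∈ T j, dist a c ≤ ρ j := by
      intro a ha
      have : a ∈ Metric.closedBall y (2 * (M * 2 ^ j)) ∩ S :=
        ⟨(Metric.dist_le_diam_of_mem C.finite_toSet.isBounded ha (hact.1 hyA)).trans h2, hC ha⟩
      simpa using hTcov j this
    obtain ⟨a₁, ha₁, a₂, ha₂, h12⟩ : ∃ a₁ ∈ C, ∃ a₂ ∈ C, M * 2 ^ j < dist a₁ a₂ := by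
      by_contra! h
      exact absurd (Metric.diam_le_of_forall_dist_le (by positivity) h) (not_le.2 h1)
    obtain ⟨c₁, hc₁, h1c⟩ := hcov a₁ ha₁
    obtain ⟨c₂, hc₂, h2c⟩ := hcov a₂ ha₂
    rw [Finset.card_pos]
    refine ⟨(c₁, c₂), ?_⟩
    simp only [livePairs, Z, Finset.mem_filter, Finset.mem_product]
    refine ⟨⟨⟨hc₁, hc₂⟩, ?_⟩, ⟨a₁, ha₁, h1c⟩, ⟨a₂, ha₂, h2c⟩⟩
    -- Two points of the cell more than `M 2^j` apart have net centres at least `M 2^j - 2 ρ j ≥ M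
    -- 2^j / 2` apart, so a pair is live.
    have h3 := dist_triangle4_left c₁ c₂ a₁ a₂
    rw [dist_comm c₁ a₁, dist_comm c₂ a₂] at h3
    have h4 := (le_mul_of_one_le_right (hρ0 j).le hd1).trans (hρM j)
    have h5 : 0 < M * 2 ^ j := by positivity
    norm_num at h4
    linarith
  rw [hset]
  refine (treeLaw_forall_active_le S pivot hAS active
    (fun C C' h hact => ⟨hact.1.trans h, hact.2.trans_le (hdiam_mono _ _ h)⟩)
    (fun C => ENNReal.ofReal (potential J Λ Z ρ C))
    (fun C => ENNReal.ofReal (12 * r * Real.sqrt d / Metric.diam (C : Set (Pt D))))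
    -- The `+ 1` keeps `q₀` positive even if `S` has diameter `0`.
    (q₀ := ENNReal.ofReal (12 * r * Real.sqrt d / (Metric.diam (S : Set (Pt D)) + 1)))
    ?_ ENNReal.ofReal_ne_top ?_ ?_ ?_ ENNReal.ofReal_ne_top).trans ?_
  · have := Metric.diam_nonneg (s := (S : Set (Pt D)))
    rw [Ne, ENNReal.ofReal_eq_zero, not_le]
    positivity
  · intro C hC hact
    have h1 : 0 < Metric.diam (C : Set (Pt D)) := hM.trans hact.2
    have h2 := hdiam_mono _ _ hC
    refine ENNReal.ofReal_le_ofReal ?_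
    gcongr
    linarith
  · intro a C hC hact
    refine choiceLaw_split_le hd hS (hM.trans hact.2) hact.1 (y := y) hr fun z hz => ?_
    have := Finset.mem_filter.1 (Finset.mem_coe.1 hz)
    exact ⟨this.2, this.1⟩
  · intro a C hC hact
    obtain ⟨j, hj, h1, h2, h3⟩ := hlive C hC hact
    have hMj : 0 < M * 2 ^ j := by positivity
    refine le_trans ?_ (lintegral_potential_child_add_le hΛ Z ρ (p := pivot a C) hj h3
      (κ := 1 / 15360) (fun q hq => ?_) active ?_)
    · refine add_le_add_right (ENNReal.ofReal_le_ofReal ?_) _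
      calc 12 * r * Real.sqrt d / Metric.diam (C : Set (Pt D))
          ≤ 12 * r * Real.sqrt d / (M * 2 ^ j) := by gcongr
        _ = _ := by simp only [Λ]; ring
    · simp only [livePairs, Z, Finset.mem_filter] at hq
      obtain ⟨⟨_, hfar⟩, ⟨a₁, ha₁, haq₁⟩, ⟨a₂, ha₂, haq₂⟩⟩ := hq
      exact le_choiceLaw_separates hd hS (Finset.coe_subset.2 hC) (hpivot a C ⟨a₁, ha₁⟩) hMj h2
        (hρ0 j) (hρM j) ha₁ ha₂ haq₁ haq₂ hfar
    · rintro w ⟨ht, hf⟩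
      exact disjoint_child (b := true) (ht.1 hyA) (hf.1 hyA)
  · refine ENNReal.ofReal_le_ofReal ?_
    have hlog : ∀ j, logPotential (livePairs (Z j) (ρ j) S).card ≤
        1 + 2 * d * m * Real.log 2 := by
      intro j
      have hcard : (livePairs (Z j) (ρ j) S).card ≤ 2 ^ (2 * d * m) := by
        refine ((Finset.card_filter_le _ _).trans (Finset.card_filter_le _ _)).trans ?_
        rw [Finset.card_product, mul_assoc, two_mul, pow_add]
        exact Nat.mul_le_mul (hTcard j) (hTcard j)
      refine (logPotential_mono hcard).trans ?_
      rw [logPotential, if_neg (by positivity)]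
      push_cast
      rw [Real.log_pow]
      push_cast
      exact le_rfl
    calc potential J Λ Z ρ S
        ≤ ∑ j ∈ Finset.range J, Λ j * (1 + 2 * d * m * Real.log 2) :=
          Finset.sum_le_sum fun j _ => mul_le_mul_of_nonneg_left (hlog j) (hΛ j)
      _ = 15360 * 12 * (1 + 2 * d * m * Real.log 2) * r * Real.sqrt d / M *
            ∑ j ∈ Finset.range J, ((2 : ℝ) ^ j)⁻¹ := by
          rw [Finset.mul_sum]
          refine Finset.sum_congr rfl fun j _ => ?_
          simp only [Λ]
          field_simp
      _ ≤ 15360 * 12 * (1 + 2 * d * m * Real.log 2) * r * Real.sqrt d / M * 2 := by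
          have : 0 < Real.log 2 := Real.log_pos (by norm_num)
          gcongr
          exact sum_inv_two_pow_le J
      _ = _ := by ring

/-! ### Constants and conclusion -/

theorem DoublingBound.mono {D : ℕ} {S : Set (Pt D)} {k l : ℕ} (h : DoublingBound S k)
    (hkl : k ≤ l) : DoublingBound S l := fun x r => by
  obtain ⟨T, hT, hcov⟩ := h x r
  exact ⟨T, hT.trans (Nat.pow_le_pow_right (by norm_num) hkl), hcov⟩

theorem doublingBound_of_doublingDim_le {D : ℕ} {S : Set (Pt D)} {d : ℕ}
    (h : doublingDim S ≤ d) : DoublingBound S d := by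
  by_contra hd
  have : ((d + 1 : ℕ) : ℕ∞) ≤ doublingDim S := by
    refine le_iInf₂ fun k hk => ?_
    rw [Nat.cast_le]
    by_contra! hkd
    exact hd (hk.mono (by omega))
  have h2 := this.trans h
  rw [Nat.cast_le] at h2
  omega

theorem cellRadius_le_diam {D : ℕ} (C : Finset (Pt D)) :
    cellRadius C ≤ Metric.diam (C : Set (Pt D)) := by
  refine csInf_le ⟨0, fun r hr => hr.1⟩ ⟨Metric.diam_nonneg, ?_⟩
  rcases C.eq_empty_or_nonempty with rfl | ⟨y, hy⟩
  · exact ⟨0, by simp⟩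
  · exact ⟨y, fun z hz => Metric.dist_le_diam_of_mem C.finite_toSet.isBounded hz hy⟩

/-- Taking `m = 19 + ⌈log₂ d⌉` gives `m log 2 ≤ 20 log 2 + log d ≤ 21 log d`, and `1 ≤ d log d`
absorbs the remaining `1`. This is the source of the factor `log d` and the place where `d ≥ 2`
matters. -/
theorem exists_two_pow_ge_mul_sqrt {d : ℕ} (hd : 2 ≤ d) :
    ∃ m : ℕ, 2 ^ 19 * Real.sqrt d ≤ 2 ^ m ∧
      1 + 2 * d * m * Real.log 2 ≤ 43 * (d * Real.log d) := by
  have hd' : (2 : ℝ) ≤ d := by exact_mod_cast hd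
  have hl2 : 1 / 2 < Real.log 2 := by linarith [Real.log_two_gt_d9]
  have hld : Real.log 2 ≤ Real.log d := Real.log_le_log (by norm_num) hd'
  refine ⟨19 + Nat.clog 2 d, ?_, ?_⟩
  · rw [pow_add]
    refine mul_le_mul_of_nonneg_left ?_ (by positivity)
    have h1 : (d : ℝ) ≤ 2 ^ Nat.clog 2 d := by exact_mod_cast Nat.le_pow_clog (by norm_num) d
    refine le_trans ?_ h1
    rw [Real.sqrt_le_left (by positivity)]
    nlinarith
  · have h2 : (2 : ℝ) ^ (Nat.clog 2 d - 1) ≤ d := by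
      exact_mod_cast (Nat.pow_pred_clog_lt_self (by norm_num) (by omega : 1 < d)).le
    have h3 := Real.log_le_log (by positivity) h2
    have h4 : 1 ≤ Nat.clog 2 d := Nat.clog_pos (by norm_num) hd
    rw [Real.log_pow, Nat.cast_sub h4] at h3
    push_cast at h3 ⊢
    have h5 : (19 + (Nat.clog 2 d : ℝ)) * Real.log 2 ≤ 21 * Real.log d := by linarith
    have h6 : 1 ≤ d * Real.log d := by nlinarith
    calc 1 + 2 * (d : ℝ) * (19 + Nat.clog 2 d) * Real.log 2
        = 1 + 2 * d * ((19 + Nat.clog 2 d) * Real.log 2) := by ring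
      _ ≤ d * Real.log d + 2 * d * (21 * Real.log d) := by gcongr
      _ = _ := by ring

open Classical in
theorem treeLaw_exists_small_cell {D : ℕ} [NeZero D] {d : ℕ} (hd : 2 ≤ d) {S : Finset (Pt D)}
    (hS : DoublingBound (S : Set (Pt D)) d) (pivot : Node → Finset (Pt D) → Pt D)
    (hpivot : ∀ (a : Node) (C : Finset (Pt D)), C.Nonempty → pivot a C ∈ C) {y : Pt D}
    (hy : y ∈ S) {R : ℝ} (hR : 0 < R) :
    3 / 4 < treeLaw D {ω | ∃ a, (S.filter fun z => dist z y ≤ 2 * R) ⊆ cell S pivot ω a ∧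
      Metric.diam (cell S pivot ω a : Set (Pt D)) ≤
        200000000 * R * d * Real.sqrt d * Real.log d} := by
  have hd' : (2 : ℝ) ≤ d := by exact_mod_cast hd
  have hld : 0 < Real.log d := Real.log_pos (by linarith)
  have hsd : 0 < Real.sqrt d := Real.sqrt_pos.2 (by linarith)
  obtain ⟨m, hm, hmd⟩ := exists_two_pow_ge_mul_sqrt hd
  set M := 200000000 * R * d * Real.sqrt d * Real.log d with hMdef
  have hM : 0 < M := by positivity
  set E := {ω | ∃ a, (S.filter fun z => dist z y ≤ 2 * R) ⊆ cell S pivot ω a ∧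
      Metric.diam (cell S pivot ω a : Set (Pt D)) ≤ M} with hE
  have hEc : Eᶜ = {ω | ∀ a, (S.filter fun z => dist z y ≤ 2 * R) ⊆ cell S pivot ω a →
      M < Metric.diam (cell S pivot ω a : Set (Pt D))} := by
    ext ω
    simp [hE]
  have hEm : MeasurableSet E := by
    have : E = ⋃ a : Node, ⋃ C ∈ S.powerset.filter fun C =>
        (S.filter fun z => dist z y ≤ 2 * R) ⊆ C ∧ Metric.diam (C : Set (Pt D)) ≤ M,
        {ω | cell S pivot ω a = C} := by
      ext ω
      simp only [hE, Set.mem_iUnion, Set.mem_ofPred_eq, Finset.mem_filter, Finset.mem_powerset,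
        exists_prop]
      refine exists_congr fun a => ⟨fun h => ⟨_, ⟨cell_subset S pivot ω a, h⟩, rfl⟩, ?_⟩
      rintro ⟨C, ⟨_, h⟩, rfl⟩
      exact h
    rw [this]
    exact MeasurableSet.iUnion fun a => Finset.measurableSet_biUnion _ fun C _ =>
      measurableSet_cell_eq S pivot a C
  -- With `r = 2R` the bound has constant `24 · 15360 · 43 · 2 = 31703040`, below a quarter of the
  -- constant in `M`.
  have hfail : treeLaw D Eᶜ < 1 / 4 := by
    rw [hEc]
    refine (treeLaw_forall_lt_diam_le (by omega) hS pivot hpivot hy (by positivity) hM hm).trans_lt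
      ?_
    rw [show (1 / 4 : ℝ≥0∞) = ENNReal.ofReal (1 / 4) by
      rw [ENNReal.ofReal_div_of_pos (by norm_num)]; simp]
    rw [ENNReal.ofReal_lt_ofReal_iff (by norm_num), div_lt_iff₀ hM]
    calc 24 * 15360 * (1 + 2 * d * m * Real.log 2) * (2 * R) * Real.sqrt d
        ≤ 24 * 15360 * (43 * (d * Real.log d)) * (2 * R) * Real.sqrt d := by gcongr
      _ = 31703040 * (R * d * Real.sqrt d * Real.log d) := by ring
      _ < 50000000 * (R * d * Real.sqrt d * Real.log d) := by
          have : 0 < R * d * Real.sqrt d * Real.log d := by positivity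
          linarith
      _ = _ := by rw [hMdef]; ring
  have hreal : (treeLaw D).real E + (treeLaw D).real Eᶜ = 1 := probReal_add_probReal_compl hEm
  have h1 : (treeLaw D).real Eᶜ < 1 / 4 := by
    have := (ENNReal.toReal_lt_toReal (measure_ne_top _ _) (by simp)).2 hfail
    simpa [measureReal_def] using this
  rw [show (3 / 4 : ℝ≥0∞) = ENNReal.ofReal (3 / 4) by
    rw [ENNReal.ofReal_div_of_pos (by norm_num)]; simp]
  rw [← ofReal_measureReal, ENNReal.ofReal_lt_ofReal_iff_of_nonneg (by norm_num)]
  linarith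

end RPTree

theorem theorem4 :
    ∃ c₆ : ℝ, 0 < c₆ ∧
      ∀ (D : ℕ) [NeZero D] (d : ℕ), 2 ≤ d →
      ∀ S : Finset (RPTree.Pt D), RPTree.doublingDim (S : Set (RPTree.Pt D)) ≤ (d : ℕ∞) →
      ∀ pivot : RPTree.Node → Finset (RPTree.Pt D) → RPTree.Pt D,
        (∀ (a : RPTree.Node) (C : Finset (RPTree.Pt D)), C.Nonempty → pivot a C ∈ C) →
      ∀ (x : RPTree.Pt D) (R : ℝ), 0 < R →
        3 / 4 < RPTree.treeLaw D
          {ω | ∃ a : RPTree.Node,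
            Metric.closedBall x R ∩ (S : Set (RPTree.Pt D)) ⊆
                (RPTree.cell S pivot ω a : Set (RPTree.Pt D)) ∧
              RPTree.cellRadius (RPTree.cell S pivot ω a) ≤
                c₆ * R * d * Real.sqrt d * Real.log d} := by
  refine ⟨200000000, by norm_num, fun D _ d hd S hS pivot hpivot x R hR => ?_⟩
  have hld : 0 ≤ Real.log d := Real.log_natCast_nonneg d
  rcases S.eq_empty_or_nonempty with rfl | hne
  · have : {ω | ∃ a : RPTree.Node,
        Metric.closedBall x R ∩ ((∅ : Finset (RPTree.Pt D)) : Set (RPTree.Pt D)) ⊆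
          (RPTree.cell ∅ pivot ω a : Set (RPTree.Pt D)) ∧
            RPTree.cellRadius (RPTree.cell ∅ pivot ω a) ≤
              200000000 * R * d * Real.sqrt d * Real.log d} = Set.univ := by
      refine Set.eq_univ_of_forall fun ω => ⟨[], by simp, ?_⟩
      refine (RPTree.cellRadius_le_diam _).trans ?_
      simp only [RPTree.cell, Finset.coe_empty, Metric.diam_empty]
      positivity
    rw [this, measure_univ]
    exact ENNReal.div_lt_of_lt_mul (by norm_num)
  -- Recentring at a data point doubles the radius but makes `A` nonempty, so that the two children
  -- of a cell cannot both contain it.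
  obtain ⟨y, hyS, hy⟩ : ∃ y ∈ S, Metric.closedBall x R ∩ (S : Set (RPTree.Pt D)) ⊆
      Metric.closedBall y (2 * R) := by
    rcases (Metric.closedBall x R ∩ (S : Set (RPTree.Pt D))).eq_empty_or_nonempty with h | ⟨y, hy⟩
    · obtain ⟨y, hy⟩ := hne
      exact ⟨y, hy, by simp [h]⟩
    · refine ⟨y, hy.2, fun z hz => ?_⟩
      have h1 := dist_triangle_right z y x
      have h2 := Metric.mem_closedBall.1 hy.1
      have h3 := Metric.mem_closedBall.1 hz.1
      rw [Metric.mem_closedBall]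
      linarith
  classical
  refine (RPTree.treeLaw_exists_small_cell hd (RPTree.doublingBound_of_doublingDim_le hS) pivot
    hpivot hyS hR).trans_le (measure_mono ?_)
  rintro ω ⟨a, ha, hdiam⟩
  refine ⟨a, fun z hz => ?_, (RPTree.cellRadius_le_diam _).trans hdiam⟩
  refine ha ?_
  rw [Finset.mem_filter]
  exact ⟨hz.2, hy hz⟩
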